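/- **Setting.** Let $\mathbf y=\mathbf f+\boldsymbol\epsilon$ with $\mathbf f=\mathbf X\boldsymbol\beta\in\mathbb R^n$, where $\mathbf X\in\mathbb R^{n\times p}$ is a nonrandom matrix of full column rank and $\epsilon_1,\dots,\epsilon_n$ are i.i.d. with $\mathbb E\epsilon_i=0$ and $\mathbb E\epsilon_i^2=\sigma^2>0$. The errors are $\eta$-sub-Gaussian: $\mathbb E e^{t\epsilon_i}\le e^{\eta^2t^2/2}$ for all $t\in\mathbb R$. Let $\mathcal M=\{\{1,\dots,k_m\}:1\le m\le M\}$ with $M\ge 1$ and $0=k_0<k_1<\dots<k_M\le p$ be a nested candidate set. Let $\mathbf P_m$ be the orthogonal projection of $\mathbb R^n$ onto the span of the first $k_m$ columns of $\mathbf X$, and for $\mathbf w$ in the simplex $\mathcal W=\{\mathbf w\in[0,1]^M:\sum_m w_m=1\}$ put $\mathbf P_{\mathbf w}=\sum_m w_m\mathbf P_m$ and $$L_n(\mathbf w)=\tfrac1n\|\mathbf P_{\mathbf w}\mathbf y-\mathbf f\|^2,\qquad R_n(\mathbf w)=\mathbb E L_n(\mathbf w)=\tfrac1n\|\mathbf f-\mathbf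 P_{\mathbf w}\mathbf f\|^2+\tfrac{\sigma^2}{n}\operatorname{tr}(\mathbf P_{\mathbf w}^\top\mathbf P_{\mathbf w}).$$ Let $\mathbf w^*$ be a minimizer of $R_n$ over $\mathcal W$. Let $\hat\sigma^2$ be any random variable with $\mathbb E(\hat\sigma^2-\sigma^2)^2<\infty$ (an estimator of $\sigma^2$; otherwise the bound below is trivial), and let $\hat{\mathbf w}$ be a (measurable) minimizer over $\mathcal W$ of the Mallows criterion $\frac1n\|\mathbf y-\mathbf P_{\mathbf w}\mathbf y\|^2+\frac{2\hat\sigma^2}{n}\sum_m k_mw_m$. Let $\boldsymbol\phi_1,\dots,\boldsymbol\phi_p$ be unit vectors such that $\boldsymbol\phi_j\boldsymbol\phi_j^\top$ is the difference of the orthogonal projections onto the spans of the first $j$ and of the first $j-1$ columns of $\mathbf X$, and put $\theta_j=\boldsymbol\phi_j^\top\mathbf f/\sqrt n$, $S_j=\sum_{l=k_j+1}^{k_M}\theta_l^2$ for $0\le j\le M$ (so $S_M=0$), $M'=\min\{1\le j\le M:S_j=0\}$, $$\psi(\mathcal M)=\Big[M\wedge\Big(1+\sum_{j=1}^{M-1}\frac{k_{j+1}-k_j}{4k_j}+\sum_{j=1}^{M'-1}\frac{S_{j-1}-S_j}{4S_j}\Big)\Big](1+\log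 M)^2,$$ $$\rho=\frac{k_M}{n\sigma^2}\mathbb E(\hat\sigma^2-\sigma^2)^2+\Big[\frac{k_M}{n\sigma^2}\mathbb E(\hat\sigma^2-\sigma^2)^2\Big]^{1/2}[R_n(\mathbf w^*)]^{1/2}.$$ **Theorem 1.** For every $\kappa$ there is a constant $C>0$, depending only on $\kappa$, such that in every such setting (any $n,p,M,\mathbf X,\boldsymbol\beta$, any error distribution, any $\mathcal M$ and $\hat\sigma^2$) with $\eta\le\kappa\sigma$, and with $Q$ denoting either the risk $\mathbb E L_n(\hat{\mathbf w})$ or the plug-in risk $\mathbb E R_n(\hat{\mathbf w})=\frac1n\mathbb E\|\mathbf f-\mathbf P_{\hat{\mathbf w}}\mathbf f\|^2+\frac{\sigma^2}{n}\mathbb E\operatorname{tr}(\mathbf P_{\hat{\mathbf w}}^\top\mathbf P_{\hat{\mathbf w}})$ (both are finite), $$Q\le R_n(\mathbf w^*)+\frac{C\sigma^2}{n}\psi(\mathcal M)+\frac{C\sigma}{\sqrt n}[\psi(\mathcal M)]^{1/2}[R_n(\mathbf w^*)]^{1/2}+C\rho .$$ -/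

import Mathlib

open MeasureTheory ProbabilityTheory Matrix

namespace MMA

/-- The least squares projection matrix `X_I (X_Iᵀ X_I)⁻¹ X_Iᵀ` of the model with regressors `I`. -/
noncomputable def projMatrix {n p : ℕ} (X : Matrix (Fin n) (Fin p) ℝ) (I : Finset (Fin p)) :
    Matrix (Fin n) (Fin n) ℝ :=
  X.submatrix id (fun j : I => (j : Fin p)) *
    ((X.submatrix id (fun j : I => (j : Fin p)))ᵀ * X.submatrix id (fun j : I => (j : Fin p)))⁻¹ *
    (X.submatrix id (fun j : I => (j : Fin p)))ᵀ

/-- The index set `{1, …, k}` of the first `k` regressors (zero-based: the indices below `k`). -/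
def firstIdx (p k : ℕ) : Finset (Fin p) := Finset.univ.filter (fun j => (j : ℕ) < k)

/-- The nested candidate set `{1, …, k_1} ⊂ … ⊂ {1, …, k_M}`; the index `m : Fin M` stands for the
candidate number `m + 1`. -/
def nestedModels (p M : ℕ) (k : ℕ → ℕ) : Fin M → Finset (Fin p) :=
  fun m => firstIdx p (k ((m : ℕ) + 1))

/-- `P_{w|M} = ∑ m, w_m P_m`. -/
noncomputable def avgMatrix {n p M : ℕ} (X : Matrix (Fin n) (Fin p) ℝ)
    (I : Fin M → Finset (Fin p)) (w : Fin M → ℝ) : Matrix (Fin n) (Fin n) ℝ :=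
  ∑ m, w m • projMatrix X (I m)

/-- The model averaging estimator `P_{w|M} y`. -/
noncomputable def maEstimator {n p M : ℕ} (X : Matrix (Fin n) (Fin p) ℝ)
    (I : Fin M → Finset (Fin p)) (w : Fin M → ℝ) (y : Fin n → ℝ) : Fin n → ℝ :=
  avgMatrix X I w *ᵥ y

/-- The squared Euclidean norm. -/
def sqNorm {n : ℕ} (v : Fin n → ℝ) : ℝ := ∑ i, v i ^ 2

/-- The loss `L_n(w|M, f) = n⁻¹ ‖P_{w|M} y - f‖²`. -/
noncomputable def maLoss {n p M : ℕ} (X : Matrix (Fin n) (Fin p) ℝ)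
    (I : Fin M → Finset (Fin p)) (f : Fin n → ℝ) (w : Fin M → ℝ) (y : Fin n → ℝ) : ℝ :=
  1 / (n : ℝ) * sqNorm (maEstimator X I w y - f)

/-- The risk `R_n(w|M, f) = E L_n(w|M, f)` of a fixed weight vector, with `y = f + ε`. -/
noncomputable def maRisk {Ω : Type*} [MeasurableSpace Ω] (P : Measure Ω) {n p M : ℕ}
    (X : Matrix (Fin n) (Fin p) ℝ) (I : Fin M → Finset (Fin p)) (f : Fin n → ℝ)
    (ε : Fin n → Ω → ℝ) (w : Fin M → ℝ) : ℝ :=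
  ∫ ω, maLoss X I f w (fun i => f i + ε i ω) ∂P

/-- The expression `n⁻¹ ‖f - P_w f‖² + n⁻¹ σ² tr(P_wᵀ P_w)`, into which a data-dependent weight
vector is plugged. -/
noncomputable def plugInRisk {n p M : ℕ} (X : Matrix (Fin n) (Fin p) ℝ)
    (I : Fin M → Finset (Fin p)) (f : Fin n → ℝ) (σ : ℝ) (w : Fin M → ℝ) : ℝ :=
  1 / (n : ℝ) * sqNorm (f - avgMatrix X I w *ᵥ f) +
    σ ^ 2 / (n : ℝ) * ((avgMatrix X I w)ᵀ * avgMatrix X I w).trace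

/-- The Mallows criterion
`C_n(w|M, y) = n⁻¹ ‖y - P_{w|M} y‖² + 2 n⁻¹ s ∑ m, |I_m| w_m`, where `s` is the value of the
variance estimator. -/
noncomputable def mmaCriterion {n p M : ℕ} (X : Matrix (Fin n) (Fin p) ℝ)
    (I : Fin M → Finset (Fin p)) (s : ℝ) (y : Fin n → ℝ) (w : Fin M → ℝ) : ℝ :=
  1 / (n : ℝ) * sqNorm (y - maEstimator X I w y) +
    2 * s / (n : ℝ) * ∑ m, ((I m).card : ℝ) * w m

/-- `φ_1, …, φ_p` are unit vectors with `P_j - P_{j-1} = φ_j φ_jᵀ`, where `P_j` is the projection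
matrix of the first `j` regressors (`P_0 = 0`). They are unique up to sign. -/
def IsNestedBasis {n p : ℕ} (X : Matrix (Fin n) (Fin p) ℝ) (φ : Fin p → Fin n → ℝ) : Prop :=
  ∀ j : Fin p, sqNorm (φ j) = 1 ∧
    projMatrix X (firstIdx p ((j : ℕ) + 1)) - projMatrix X (firstIdx p (j : ℕ)) =
      vecMulVec (φ j) (φ j)

section
variable {n p : ℕ} (X : Matrix (Fin n) (Fin p) ℝ)

theorem gram_det_isUnit (hX : LinearIndependent ℝ X.col) (I : Finset (Fin p)) :
    IsUnit ((X.submatrix id (fun j : I => (j : Fin p)))ᵀ *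
      X.submatrix id (fun j : I => (j : Fin p))).det := by
  have h1 : LinearIndependent ℝ (X.submatrix id (fun j : I => (j : Fin p))).col :=
    hX.comp (fun j : I => (j : Fin p)) Subtype.val_injective
  have h2 := Matrix.PosDef.conjTranspose_mul_self (X.submatrix id (fun j : I => (j : Fin p)))
    (Matrix.mulVec_injective_iff.2 h1)
  rw [Matrix.conjTranspose_eq_transpose_of_trivial] at h2
  exact (Matrix.isUnit_iff_isUnit_det _).1 h2.isUnit

theorem projMatrix_transpose (I : Finset (Fin p)) : (projMatrix X I)ᵀ = projMatrix X I := by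
  simp [projMatrix, Matrix.transpose_mul, Matrix.transpose_nonsing_inv, Matrix.mul_assoc]

theorem projMatrix_mul_submatrix (hX : LinearIndependent ℝ X.col) (I : Finset (Fin p)) :
    projMatrix X I * X.submatrix id (fun j : I => (j : Fin p)) =
      X.submatrix id (fun j : I => (j : Fin p)) := by
  rw [projMatrix, Matrix.mul_assoc, Matrix.mul_assoc,
    Matrix.nonsing_inv_mul _ (gram_det_isUnit X hX I), Matrix.mul_one]

theorem projMatrix_mul_of_subset (hX : LinearIndependent ℝ X.col) {I J : Finset (Fin p)}
    (h : I ⊆ J) : projMatrix X J * projMatrix X I = projMatrix X I := by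
  have h1 : projMatrix X J * X.submatrix id (fun j : I => (j : Fin p)) =
      X.submatrix id (fun j : I => (j : Fin p)) := by
    ext a b
    exact congrFun (congrFun (projMatrix_mul_submatrix X hX J) a) ⟨b, h b.2⟩
  conv_lhs => rw [projMatrix.eq_1 X I, ← Matrix.mul_assoc, ← Matrix.mul_assoc, h1]
  rw [projMatrix]

theorem projMatrix_mul_of_subset' (hX : LinearIndependent ℝ X.col) {I J : Finset (Fin p)}
    (h : I ⊆ J) : projMatrix X I * projMatrix X J = projMatrix X I := by
  have := congrArg Matrix.transpose (projMatrix_mul_of_subset X hX h)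
  rwa [Matrix.transpose_mul, projMatrix_transpose, projMatrix_transpose] at this

theorem projMatrix_trace (hX : LinearIndependent ℝ X.col) (I : Finset (Fin p)) :
    (projMatrix X I).trace = I.card := by
  rw [projMatrix, Matrix.mul_assoc, Matrix.trace_mul_comm, Matrix.mul_assoc,
    Matrix.nonsing_inv_mul _ (gram_det_isUnit X hX I), Matrix.trace_one]
  simp

/-- The basis exists for every design of full column rank. -/
theorem exists_isNestedBasis (hX : LinearIndependent ℝ X.col) :
    ∃ φ : Fin p → Fin n → ℝ, IsNestedBasis X φ := by
  have key : ∀ j : Fin p, ∃ v : Fin n → ℝ, sqNorm v = 1 ∧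
      projMatrix X (firstIdx p ((j : ℕ) + 1)) - projMatrix X (firstIdx p (j : ℕ)) =
        vecMulVec v v := by
    intro j
    have hsub : firstIdx p (j : ℕ) ⊆ firstIdx p ((j : ℕ) + 1) := by
      intro a
      simp only [firstIdx, Finset.mem_filter, Finset.mem_univ, true_and]
      omega
    have hins : firstIdx p ((j : ℕ) + 1) = insert j (firstIdx p (j : ℕ)) := by
      ext a
      simp only [firstIdx, Finset.mem_filter, Finset.mem_univ, true_and, Finset.mem_insert,
        Fin.ext_iff]
      omega
    have hnot : j ∉ firstIdx p (j : ℕ) := by simp [firstIdx]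
    set D := projMatrix X (firstIdx p ((j : ℕ) + 1)) - projMatrix X (firstIdx p (j : ℕ)) with hD
    have hDt : Dᵀ = D := by
      rw [hD, Matrix.transpose_sub, projMatrix_transpose, projMatrix_transpose]
    have hDD : D * D = D := by
      rw [hD, Matrix.sub_mul, Matrix.mul_sub, Matrix.mul_sub,
        projMatrix_mul_of_subset X hX hsub, projMatrix_mul_of_subset' X hX hsub,
        projMatrix_mul_of_subset X hX (Finset.Subset.refl _),
        projMatrix_mul_of_subset X hX (Finset.Subset.refl _)]
      simp
    have htr : D.trace = 1 := by
      rw [hD, Matrix.trace_sub, projMatrix_trace X hX, projMatrix_trace X hX, hins,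
        Finset.card_insert_of_notMem hnot]
      push_cast
      ring
    have hD0 : D ≠ 0 := by
      intro h
      rw [h, Matrix.trace_zero] at htr
      exact zero_ne_one htr
    clear_value D
    obtain ⟨u, hu⟩ : ∃ u, D *ᵥ u ≠ 0 := by
      by_contra h
      push Not at h
      exact hD0 (Matrix.ext_of_mulVec_single fun i => by rw [h, Matrix.zero_mulVec])
    have hpos : 0 < (D *ᵥ u) ⬝ᵥ (D *ᵥ u) :=
      lt_of_le_of_ne (Finset.sum_nonneg fun i _ => mul_self_nonneg _)
        (fun h => hu (dotProduct_self_eq_zero.1 h.symm))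
    set r := Real.sqrt ((D *ᵥ u) ⬝ᵥ (D *ᵥ u)) with hr
    have hr2 : r * r = (D *ᵥ u) ⬝ᵥ (D *ᵥ u) := Real.mul_self_sqrt hpos.le
    have hr0 : r ≠ 0 := (Real.sqrt_pos.2 hpos).ne'
    set v : Fin n → ℝ := r⁻¹ • (D *ᵥ u) with hv
    have hDv : D *ᵥ v = v := by
      rw [hv, Matrix.mulVec_smul, Matrix.mulVec_mulVec, hDD]
    have hvv : v ⬝ᵥ v = 1 := by
      rw [hv, smul_dotProduct, dotProduct_smul, ← hr2, smul_eq_mul, smul_eq_mul]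
      field_simp
    have hvD : v ᵥ* D = v := by
      rw [← Matrix.mulVec_transpose, hDt, hDv]
    refine ⟨v, ?_, ?_⟩
    · rw [← hvv]
      exact Finset.sum_congr rfl fun i _ => sq _
    · have hE : (D - vecMulVec v v)ᵀ * (D - vecMulVec v v) = D - vecMulVec v v := by
        rw [Matrix.transpose_sub, hDt, Matrix.transpose_vecMulVec, Matrix.sub_mul, Matrix.mul_sub,
          Matrix.mul_sub, hDD, Matrix.mul_vecMulVec, Matrix.vecMulVec_mul, hDv, hvD,
          Matrix.vecMulVec_mul_vecMulVec, hvv]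
        simp
      have hE0 : ((D - vecMulVec v v)ᵀ * (D - vecMulVec v v)).trace = 0 := by
        rw [hE, Matrix.trace_sub, htr, Matrix.trace_vecMulVec, hvv, sub_self]
      rw [← Matrix.conjTranspose_eq_transpose_of_trivial,
        Matrix.trace_conjTranspose_mul_self_eq_zero_iff] at hE0
      exact sub_eq_zero.1 hE0
  choose φ hφ using key
  exact ⟨φ, hφ⟩

end

/-- The transformed coefficients `θ_j = φ_jᵀ f / √n`. -/
noncomputable def transCoeff {n p : ℕ} (φ : Fin p → Fin n → ℝ) (f : Fin n → ℝ) (j : Fin p) : ℝ :=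
  (φ j ⬝ᵥ f) / Real.sqrt (n : ℝ)

/-- `S_j = ∑_{l = k_j + 1}^{k_M} θ_l²` (zero-based: over `k_j ≤ l < k_M`); in particular
`S_M = 0`. -/
noncomputable def tailS {p : ℕ} (θ : Fin p → ℝ) (k : ℕ → ℕ) (M j : ℕ) : ℝ :=
  ∑ l ∈ Finset.univ.filter (fun l : Fin p => k j ≤ (l : ℕ) ∧ (l : ℕ) < k M), θ l ^ 2

/-- `M' = min {1 ≤ j ≤ M : S_j = 0}`. -/
noncomputable def firstZero {p : ℕ} (θ : Fin p → ℝ) (k : ℕ → ℕ) (M : ℕ) : ℕ :=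
  sInf {j : ℕ | 1 ≤ j ∧ j ≤ M ∧ tailS θ k M j = 0}

/-- The complexity `ψ(M)` of the nested candidate set. -/
noncomputable def psi {p : ℕ} (θ : Fin p → ℝ) (k : ℕ → ℕ) (M : ℕ) : ℝ :=
  min (M : ℝ)
    (1 + ∑ j ∈ Finset.Icc 1 (M - 1), ((k (j + 1) : ℝ) - (k j : ℝ)) / (4 * (k j : ℝ))
      + ∑ j ∈ Finset.Icc 1 (firstZero θ k M - 1),
          (tailS θ k M (j - 1) - tailS θ k M j) / (4 * tailS θ k M j))
    * (1 + Real.log (M : ℝ)) ^ 2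

/-- The term `ρ` of the variance estimator: `kmax` is the size of the largest candidate, `mse` is
`E (σ̂² - σ²)²` and `r` is the optimal risk. -/
noncomputable def rhoTerm (n kmax : ℕ) (σ mse r : ℝ) : ℝ :=
  (kmax : ℝ) / ((n : ℝ) * σ ^ 2) * mse +
    Real.sqrt ((kmax : ℝ) / ((n : ℝ) * σ ^ 2) * mse) * Real.sqrt r

/-- The right-hand side of the risk bound: `r` is the optimal risk, `ψ` the complexity. -/
noncomputable def riskBound (C : ℝ) (n kmax : ℕ) (σ mse ψ r : ℝ) : ℝ :=
  r + C * σ ^ 2 / (n : ℝ) * ψ + C * σ / Real.sqrt (n : ℝ) * Real.sqrt ψ * Real.sqrt r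
    + C * rhoTerm n kmax σ mse r

end MMA

namespace MMA

/-! Write `g m` for the total weight of the candidates with index at least `m`. In the basis `φ`
every averaging matrix is diagonal, with the constant factor `g m` on the `m`-th block of new
regressors. Let `B m` and `D m` be the squared norm of `f` on block `m` and its dimension, `U m` the
inner product of signal and noise there, and `V m` the centred squared norm of the noise. Then `n *
R` equals `∑ (1 - g)² B + σ² ∑ g² D` plus a nonnegative constant, and loss and Mallows criterion are
sums of the same kind with additional terms in `U` and `V`.

Comparing the criterion at the minimizer with its value at a fixed weight leaves noise terms `∑ x m
* U m` with `x = 1 - g` nondecreasing and `∑ x m * V m` with `x = g` nonincreasing; passing between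
loss and risk adds the squares of these multipliers. The weights are random, so a bound uniform in
monotone `x` is needed. This is `exists_monotone_bound`: `(∑ x ξ)² ≤ Z ∑ x² a` with one random `Z`
whose mean is controlled. Summation by parts replaces `ξ` and `a` by their tail sums `T` and `S`.
The indices are grouped into levels on which `S` varies by a factor below `3`. On one level the
maximum of `T²` costs a factor `(1 + log M)²` by Rademacher–Menshov, and Cauchy–Schwarz over the
levels costs their number. That number is at most `M`, and also of order `1 + log (S 0 / S m)` for
the last positive tail, which the ratio sums in `ψ` dominate. Only second moments of increments
enter; sub-Gaussianity serves to bound the fourth moments of the errors, which control `V`.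

Both denominators `∑ x² a` are at most `n * R`, up to the factor `σ²`. Taking expectations with
Cauchy–Schwarz gives two inequalities between `L`, `r` and `t`, which are `n` times the risk, the
plug-in risk and the optimal risk. With `a = σ √ψ`, and `b` the scaled root mean squared error of
the variance estimator, the noise contributes multiples of `a √r`, `b √r` and `b √t`. Solving this
quadratic inequality for `√r` bounds `r` and `L` together (`integral_risk_selfbound`,
`le_of_selfbound`). -/

/-! ### Dyadic partial sums and the Rademacher–Menshov inequality -/

/-- The sum of the squares of the dyadic partial sums of `ξ` over `[a, a + 2 ^ r)`. -/
def dyadicEnergy (ξ : ℕ → ℝ) : ℕ → ℕ → ℝ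
  | 0, a => ξ a ^ 2
  | r + 1, a => (∑ l ∈ Finset.Ico a (a + 2 ^ (r + 1)), ξ l) ^ 2 +
      dyadicEnergy ξ r a + dyadicEnergy ξ r (a + 2 ^ r)

theorem dyadicEnergy_nonneg (ξ : ℕ → ℝ) (r a : ℕ) : 0 ≤ dyadicEnergy ξ r a := by
  induction r generalizing a with
  | zero => exact sq_nonneg _
  | succ r ih =>
    have h1 := ih a
    have h2 := ih (a + 2 ^ r)
    rw [dyadicEnergy]
    positivity

theorem sq_sum_le_dyadicEnergy (ξ : ℕ → ℝ) (r a : ℕ) :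
    (∑ l ∈ Finset.Ico a (a + 2 ^ r), ξ l) ^ 2 ≤ dyadicEnergy ξ r a := by
  cases r with
  | zero => simp [dyadicEnergy]
  | succ r =>
    have h1 := dyadicEnergy_nonneg ξ r a
    have h2 := dyadicEnergy_nonneg ξ r (a + 2 ^ r)
    rw [dyadicEnergy]
    linarith

/-- The deterministic form of the Rademacher–Menshov maximal inequality. -/
theorem sq_partialSum_le_dyadicEnergy (ξ : ℕ → ℝ) (r a m : ℕ) (hm : m ≤ 2 ^ r) :
    (∑ l ∈ Finset.Ico a (a + m), ξ l) ^ 2 ≤ (r + 1) * dyadicEnergy ξ r a := by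
  induction r generalizing a m with
  | zero =>
    have h : m = 0 ∨ m = 1 := by simp at hm; omega
    rcases h with rfl | rfl
    · simpa using dyadicEnergy_nonneg ξ 0 a
    · simp [dyadicEnergy]
  | succ r ih =>
    have h1 := dyadicEnergy_nonneg ξ r a
    have h2 := dyadicEnergy_nonneg ξ r (a + 2 ^ r)
    have h3 := sq_nonneg (∑ l ∈ Finset.Ico a (a + 2 ^ (r + 1)), ξ l)
    have hr : (0 : ℝ) ≤ r := Nat.cast_nonneg r
    rw [dyadicEnergy]
    push_cast
    rcases le_total m (2 ^ r) with h | h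
    · have := ih a m h
      nlinarith [mul_nonneg hr h2, mul_nonneg hr h3]
    · have hu := sq_sum_le_dyadicEnergy ξ r a
      have hv := ih (a + 2 ^ r) (m - 2 ^ r) (by rw [pow_succ] at hm; omega)
      have he : a + 2 ^ r + (m - 2 ^ r) = a + m := by omega
      rw [he] at hv
      rw [← Finset.sum_Ico_consecutive _ (show a ≤ a + 2 ^ r by omega)
        (show a + 2 ^ r ≤ a + m by omega)]
      set u := ∑ l ∈ Finset.Ico a (a + 2 ^ r), ξ l
      set v := ∑ l ∈ Finset.Ico (a + 2 ^ r) (a + m), ξ l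
      have hr1 : (0 : ℝ) < r + 1 := by positivity
      -- Cauchy–Schwarz with weights `1` and `r + 1`: the full left half `u` is a single dyadic sum,
      -- while `v²` already carries the factor `r + 1`. Hence the constant grows only by one per
      -- generation.
      have key : (u + v) ^ 2 ≤ (r + 2) * (u ^ 2 + v ^ 2 / (r + 1)) := by
        have : (r + 2) * (u ^ 2 + v ^ 2 / (r + 1)) - (u + v) ^ 2 =
            ((r + 1) * u - v) ^ 2 / (r + 1) := by
          field_simp
          ring
        have h0 : 0 ≤ ((r + 1) * u - v) ^ 2 / ((r : ℝ) + 1) := by positivity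
        linarith
      have hv' : v ^ 2 / (r + 1) ≤ dyadicEnergy ξ r (a + 2 ^ r) := by
        rw [div_le_iff₀ hr1]
        linarith
      refine key.trans ?_
      have : (r : ℝ) + 1 + 1 = r + 2 := by ring
      rw [this]
      apply mul_le_mul_of_nonneg_left _ (by positivity)
      linarith

section
variable {Ω : Type*} [MeasurableSpace Ω] {P : Measure Ω}

theorem integrable_dyadicEnergy {ξ : ℕ → Ω → ℝ} (hξ : ∀ m, MemLp (ξ m) 2 P) (r a : ℕ) :
    Integrable (fun ω => dyadicEnergy (fun m => ξ m ω) r a) P := by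
  induction r generalizing a with
  | zero => exact (hξ a).integrable_sq
  | succ r ih =>
    simp only [dyadicEnergy]
    exact (((memLp_finsetSum _ fun l _ => hξ l).integrable_sq).add (ih a)).add (ih _)

/-- Each of the `r + 1` generations of dyadic intervals tiles the whole block, so it contributes at
most `K` times the total mass of `a`. -/
theorem integral_dyadicEnergy_le {ξ : ℕ → Ω → ℝ} {a : ℕ → ℝ} {K : ℝ}
    (hξ : ∀ m, MemLp (ξ m) 2 P)
    (hE : ∀ i j, i ≤ j → ∫ ω, (∑ m ∈ Finset.Ico i j, ξ m ω) ^ 2 ∂P ≤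
      K * ∑ m ∈ Finset.Ico i j, a m) (r i : ℕ) :
    ∫ ω, dyadicEnergy (fun m => ξ m ω) r i ∂P ≤
      (r + 1) * (K * ∑ m ∈ Finset.Ico i (i + 2 ^ r), a m) := by
  induction r generalizing i with
  | zero => simpa [dyadicEnergy] using hE i (i + 1) (by omega)
  | succ r ih =>
    simp only [dyadicEnergy]
    have hi : Integrable (fun ω => (∑ l ∈ Finset.Ico i (i + 2 ^ (r + 1)), ξ l ω) ^ 2) P :=
      (memLp_finsetSum _ fun l _ => hξ l).integrable_sq
    rw [integral_add (by exact hi.add (integrable_dyadicEnergy hξ r i))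
      (integrable_dyadicEnergy hξ r _), integral_add hi (integrable_dyadicEnergy hξ r i)]
    have h1 := hE i (i + 2 ^ (r + 1)) (Nat.le_add_right _ _)
    have h2 := ih i
    have h3 := ih (i + 2 ^ r)
    have he : i + 2 ^ r + 2 ^ r = i + 2 ^ (r + 1) := by rw [pow_succ]; ring
    rw [he] at h3
    have h4 := Finset.sum_Ico_consecutive a (Nat.le_add_right i (2 ^ r))
      (he ▸ Nat.le_add_right _ _ : i + 2 ^ r ≤ i + 2 ^ (r + 1))
    rw [← h4] at h1 ⊢
    push_cast
    linarith

end

/-! ### Summation by parts for monotone multipliers -/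

/-- If `Δ` are the increments of `x`, the summands on the right are the increments of `x²`. Squaring
a sum over a subset `g` produces the same terms with the inner sum restricted to `g`, which is
smaller. -/
theorem sq_sum_le_sum_mul (Δ : ℕ → ℝ) (hΔ : ∀ m, 0 ≤ Δ m) (g : Finset ℕ) :
    (∑ m ∈ g, Δ m) ^ 2 ≤ ∑ m ∈ g, Δ m * (2 * ∑ l ∈ Finset.range m, Δ l + Δ m) := by
  refine Finset.induction_on_max g (by simp) fun a s hs ih => ?_
  ·
    have ha : a ∉ s := fun h => lt_irrefl a (hs a h)
    rw [Finset.sum_insert ha, Finset.sum_insert ha]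
    have h1 : ∑ m ∈ s, Δ m ≤ ∑ m ∈ Finset.range a, Δ m :=
      Finset.sum_le_sum_of_subset_of_nonneg (fun m hm => Finset.mem_range.2 (hs m hm))
        fun m _ _ => hΔ m
    nlinarith [mul_le_mul_of_nonneg_left h1 (hΔ a)]

theorem sum_range_mul_sum_range_succ (Δ c : ℕ → ℝ) (M : ℕ) :
    ∑ m ∈ Finset.range M, (∑ l ∈ Finset.range (m + 1), Δ l) * c m =
      ∑ m ∈ Finset.range M, Δ m * ∑ l ∈ Finset.Ico m M, c l := by
  simp only [Finset.range_eq_Ico, Finset.sum_mul, Finset.mul_sum]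
  exact (Finset.sum_Ico_Ico_comm 0 M fun i j => Δ i * c j).symm

theorem sq_sum_range_succ (Δ : ℕ → ℝ) (m : ℕ) :
    (∑ l ∈ Finset.range (m + 1), Δ l) ^ 2 =
      ∑ j ∈ Finset.range (m + 1), Δ j * (2 * ∑ l ∈ Finset.range j, Δ l + Δ j) := by
  induction m with
  | zero => simp; ring
  | succ m ih =>
    rw [Finset.sum_range_succ _ (m + 1), Finset.sum_range_succ _ (m + 1), ← ih]
    ring

/-- A weighted Cauchy–Schwarz bound for a sum against a monotone sequence; the tail sums of `ξ` are
controlled by `Y` on each level set of `lev`. -/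
theorem sq_sum_monotone_mul_le (M : ℕ) (ξ a x : ℕ → ℝ) (ha : ∀ m, 0 ≤ a m) (hx : Monotone x)
    (hx0 : 0 ≤ x 0) (lev : ℕ → ℕ) (Y s : ℕ → ℝ) (c : ℝ)
    (hzero : ∀ m < M, ∑ l ∈ Finset.Ico m M, a l = 0 → ∑ l ∈ Finset.Ico m M, ξ l = 0)
    (hY : ∀ m < M, 0 < ∑ l ∈ Finset.Ico m M, a l →
      (∑ l ∈ Finset.Ico m M, ξ l) ^ 2 ≤ Y (lev m))
    (hs : ∀ m < M, 0 < ∑ l ∈ Finset.Ico m M, a l →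
      0 < s (lev m) ∧ s (lev m) ≤ c * ∑ l ∈ Finset.Ico m M, a l) :
    (∑ m ∈ Finset.range M, x m * ξ m) ^ 2 ≤
      (∑ g ∈ ((Finset.range M).filter fun m => 0 < ∑ l ∈ Finset.Ico m M, a l).image lev,
        Y g / s g * c) * ∑ m ∈ Finset.range M, x m ^ 2 * a m := by
  set S : ℕ → ℝ := fun m => ∑ l ∈ Finset.Ico m M, a l with hS
  set T : ℕ → ℝ := fun m => ∑ l ∈ Finset.Ico m M, ξ l with hT
  have hS0 : ∀ m, 0 ≤ S m := fun m => Finset.sum_nonneg fun l _ => ha l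
  obtain ⟨Δ, hΔ, hxΔ⟩ : ∃ Δ : ℕ → ℝ, (∀ m, 0 ≤ Δ m) ∧
      ∀ m, x m = ∑ l ∈ Finset.range (m + 1), Δ l := by
    refine ⟨fun m => if m = 0 then x 0 else x m - x (m - 1), fun m => ?_, fun m => ?_⟩
    · dsimp only
      split_ifs
      · exact hx0
      · exact sub_nonneg.2 (hx (Nat.sub_le _ _))
    · induction m with
      | zero => simp
      | succ m ih =>
        rw [Finset.sum_range_succ, ← ih]
        simp
  -- `q m` is the increment `x m ^ 2 - x (m - 1) ^ 2`, so both sums in the claim turn into sums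
  -- against tails.
  set q : ℕ → ℝ := fun m => Δ m * (2 * ∑ l ∈ Finset.range m, Δ l + Δ m) with hq
  have hq0 : ∀ m, 0 ≤ q m := fun m => mul_nonneg (hΔ m)
    (add_nonneg (mul_nonneg zero_le_two (Finset.sum_nonneg fun l _ => hΔ l)) (hΔ m))
  have h1 : ∑ m ∈ Finset.range M, x m * ξ m = ∑ m ∈ Finset.range M, Δ m * T m := by
    simp only [hxΔ]
    exact sum_range_mul_sum_range_succ Δ ξ M
  have h2 : ∑ m ∈ Finset.range M, x m ^ 2 * a m = ∑ m ∈ Finset.range M, q m * S m := by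
    simp only [hxΔ, sq_sum_range_succ]
    exact sum_range_mul_sum_range_succ q a M
  rw [h1, h2]
  set pos := (Finset.range M).filter fun m => 0 < S m with hpos
  have hmem : ∀ m ∈ pos, m < M ∧ 0 < S m := fun m hm => by
    simpa [hpos] using hm
  have hmaps : ∀ m ∈ pos, lev m ∈ pos.image lev := fun m hm => Finset.mem_image_of_mem _ hm
  have h3 : ∑ m ∈ Finset.range M, Δ m * T m =
      ∑ g ∈ pos.image lev, ∑ m ∈ pos with lev m = g, Δ m * T m := by
    rw [Finset.sum_fiberwise_of_maps_to hmaps, hpos]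
    refine (Finset.sum_filter_of_ne fun m hm hne => ?_).symm
    by_contra hcon
    refine hne ?_
    have : T m = 0 := hzero m (Finset.mem_range.1 hm) (le_antisymm (not_lt.1 hcon) (hS0 m))
    rw [this, mul_zero]
  have h4 : ∑ g ∈ pos.image lev, ∑ m ∈ pos with lev m = g, q m * S m ≤
      ∑ m ∈ Finset.range M, q m * S m := by
    rw [Finset.sum_fiberwise_of_maps_to hmaps]
    exact Finset.sum_le_sum_of_subset_of_nonneg (Finset.filter_subset _ _)
      fun m _ _ => mul_nonneg (hq0 m) (hS0 m)
  have hg : ∀ g ∈ pos.image lev, 0 < s g ∧ 0 ≤ Y g ∧ 0 < c := by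
    intro g hg
    obtain ⟨m, hm, rfl⟩ := Finset.mem_image.1 hg
    obtain ⟨hm1, hm2⟩ := hmem m hm
    have := hs m hm1 hm2
    refine ⟨this.1, (sq_nonneg _).trans (hY m hm1 hm2), ?_⟩
    exact pos_of_mul_pos_left (this.1.trans_le this.2) hm2.le
  rw [h3]
  -- Cauchy–Schwarz over the levels only. Inside a level `Y g` and `s g` are constants, and the
  -- squared sum of `Δ` is absorbed by the sum of `q`, without losing the number of indices.
  refine le_trans (Finset.sum_sq_le_sum_mul_sum_of_sq_le_mul _
    (f := fun g => Y g / s g * c) (g := fun g => ∑ m ∈ pos with lev m = g, q m * S m)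
    (fun g hgm => ?_) (fun g hgm => ?_) fun g hgm => ?_) ?_
  · obtain ⟨h5, h6, h7⟩ := hg g hgm
    positivity
  · exact Finset.sum_nonneg fun m _ => mul_nonneg (hq0 m) (hS0 m)
  · obtain ⟨h5, h6, h7⟩ := hg g hgm
    have hA : |∑ m ∈ pos with lev m = g, Δ m * T m| ≤
        Real.sqrt (Y g) * ∑ m ∈ pos with lev m = g, Δ m := by
      refine (Finset.abs_sum_le_sum_abs _ _).trans ?_
      rw [Finset.mul_sum]
      refine Finset.sum_le_sum fun m hm => ?_
      obtain ⟨hm1, hm2⟩ := Finset.mem_filter.1 hm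
      rw [abs_mul, abs_of_nonneg (hΔ m), mul_comm]
      refine mul_le_mul_of_nonneg_right (Real.abs_le_sqrt ?_) (hΔ m)
      rw [← hm2]
      exact hY m (hmem m hm1).1 (hmem m hm1).2
    have hB : (∑ m ∈ pos with lev m = g, Δ m * T m) ^ 2 ≤
        Y g * (∑ m ∈ pos with lev m = g, Δ m) ^ 2 := by
      rw [← sq_abs]
      refine (pow_le_pow_left₀ (abs_nonneg _) hA 2).trans ?_
      rw [mul_pow, Real.sq_sqrt h6]
    have hC : s g * ∑ m ∈ pos with lev m = g, q m ≤
        c * ∑ m ∈ pos with lev m = g, q m * S m := by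
      rw [Finset.mul_sum, Finset.mul_sum]
      refine Finset.sum_le_sum fun m hm => ?_
      obtain ⟨hm1, hm2⟩ := Finset.mem_filter.1 hm
      have := (hs m (hmem m hm1).1 (hmem m hm1).2).2
      rw [hm2] at this
      calc s g * q m ≤ (c * S m) * q m := mul_le_mul_of_nonneg_right this (hq0 m)
        _ = c * (q m * S m) := by ring
    have hD := sq_sum_le_sum_mul Δ hΔ (pos.filter fun m => lev m = g)
    calc _ ≤ Y g * (∑ m ∈ pos with lev m = g, Δ m) ^ 2 := hB
      _ ≤ Y g * ∑ m ∈ pos with lev m = g, q m := mul_le_mul_of_nonneg_left hD h6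
      _ = Y g / s g * (s g * ∑ m ∈ pos with lev m = g, q m) := by field_simp
      _ ≤ Y g / s g * (c * ∑ m ∈ pos with lev m = g, q m * S m) :=
        mul_le_mul_of_nonneg_left hC (by positivity)
      _ = _ := by ring
  · refine mul_le_mul_of_nonneg_left h4 (Finset.sum_nonneg fun g hgm => ?_)
    obtain ⟨h5, h6, h7⟩ := hg g hgm
    positivity


/-! ### The maximal inequality: counting scales -/

/-- Telescoping of `log x ≤ x - 1` over consecutive ratios. This is where the ratio sums of `ψ` come
from. -/
theorem log_div_le_sum (S : ℕ → ℝ) (hS : Antitone S) (m : ℕ) (hm : 0 < S m) :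
    Real.log (S 0 / S m) ≤ ∑ j ∈ Finset.Icc 1 m, (S (j - 1) - S j) / S j := by
  induction m with
  | zero => simp
  | succ m ih =>
    have hm' : 0 < S m := hm.trans_le (hS (Nat.le_succ m))
    have h0 : 0 < S 0 := hm'.trans_le (hS (Nat.zero_le m))
    rw [Finset.sum_Icc_succ_top (by omega), Nat.add_sub_cancel]
    have h1 : S 0 / S (m + 1) = S 0 / S m * (S m / S (m + 1)) := by field_simp
    rw [h1, Real.log_mul (by positivity) (by positivity)]
    have h2 := Real.log_le_sub_one_of_pos (div_pos hm' hm)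
    have h3 : S m / S (m + 1) - 1 = (S m - S (m + 1)) / S (m + 1) := by field_simp
    have := ih hm'
    linarith

theorem natLog_two_add_two_le {M : ℕ} (hM : 1 ≤ M) :
    (Nat.log 2 M : ℝ) + 2 ≤ 2 * (1 + Real.log M) := by
  have h1 : ((2 : ℝ) ^ Nat.log 2 M) ≤ M := by
    exact_mod_cast Nat.pow_log_le_self 2 (by omega)
  have h2 := Real.log_le_log (by positivity) h1
  rw [Real.log_pow] at h2
  have h3 : (1 / 2 : ℝ) ≤ Real.log 2 := by linarith [Real.log_two_gt_d9]
  have h4 : (0 : ℝ) ≤ Nat.log 2 M := Nat.cast_nonneg _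
  nlinarith

/-- A maximal inequality, uniform over monotone multipliers: the supremum of
`(∑ x_m ξ_m)² / ∑ x_m² a_m` is controlled by the number of scales of the tail sums of `a`. -/
theorem exists_monotone_bound {Ω : Type*} [MeasurableSpace Ω] {P : Measure Ω}
    {M : ℕ} (hM : 1 ≤ M) (ξ : ℕ → Ω → ℝ) (a : ℕ → ℝ) (ha : ∀ m, 0 ≤ a m) {K : ℝ} (hK : 0 ≤ K)
    (hξ : ∀ m, MemLp (ξ m) 2 P)
    (hE : ∀ i j, i ≤ j → j ≤ M → ∫ ω, (∑ m ∈ Finset.Ico i j, ξ m ω) ^ 2 ∂P ≤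
      K * ∑ m ∈ Finset.Ico i j, a m)
    (S : ℕ → ℝ) (hS : ∀ j ≤ M, S j = ∑ m ∈ Finset.Ico j M, a m) {N : ℕ}
    (hN : ∀ j < M, 0 < S j → j ≤ N) (hNM : N ≤ M) :
    ∃ Z : Ω → ℝ, Integrable Z P ∧ (∀ ω, 0 ≤ Z ω) ∧
      ∫ ω, Z ω ∂P ≤ 192 * K * (min (M : ℝ)
        (1 + ∑ j ∈ Finset.Icc 1 N, (S (j - 1) - S j) / (4 * S j)) * (1 + Real.log M) ^ 2) ∧
      ∀ᵐ ω ∂P, ∀ x : ℕ → ℝ, Monotone x → 0 ≤ x 0 →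
        (∑ m ∈ Finset.range M, x m * ξ m ω) ^ 2 ≤
          Z ω * ∑ m ∈ Finset.range M, x m ^ 2 * a m := by
  set r := Nat.log 2 M + 1 with hr
  have hMr : M ≤ 2 ^ r := (Nat.lt_pow_succ_log_self (by norm_num) M).le
  set S' : ℕ → ℝ := fun j => ∑ m ∈ Finset.Ico j M, a m with hS'
  have hSS : ∀ j ≤ M, S j = S' j := hS
  have hanti : Antitone S' := fun i j hij =>
    Finset.sum_le_sum_of_subset_of_nonneg (Finset.Ico_subset_Ico hij le_rfl) fun m _ _ => ha m
  have hS0 : ∀ j, 0 ≤ S' j := fun j => Finset.sum_nonneg fun m _ => ha m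
  set T : ℕ → Ω → ℝ := fun j ω => ∑ m ∈ Finset.Ico j M, ξ m ω with hT
  have hTL : ∀ j, MemLp (T j) 2 P := fun j => memLp_finsetSum _ fun m _ => hξ m
  have hTE : ∀ j ≤ M, ∫ ω, T j ω ^ 2 ∂P ≤ K * S' j := fun j hj => hE j M hj le_rfl
  -- A dyadic block of length `2 ^ r` started at a representative may run past `M`; truncation by
  -- zero keeps the increment bound valid there.
  set ξ' : ℕ → Ω → ℝ := fun m ω => if m < M then ξ m ω else 0 with hξ'
  set a' : ℕ → ℝ := fun m => if m < M then a m else 0 with ha'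
  have hξL : ∀ m, MemLp (ξ' m) 2 P := by
    intro m
    by_cases h : m < M
    · simpa [hξ', h] using hξ m
    · simp [hξ', h]
  have hfil : ∀ i j, (Finset.Ico i j).filter (fun m => m < M) = Finset.Ico i (min j M) := by
    intro i j
    ext m
    simp only [Finset.mem_filter, Finset.mem_Ico, lt_min_iff]
    tauto
  have htrunc : ∀ (c : ℕ → ℝ) i j, ∑ m ∈ Finset.Ico i j, (if m < M then c m else 0) =
      ∑ m ∈ Finset.Ico i (min j M), c m := by
    intro c i j
    rw [← Finset.sum_filter, hfil]
  have hE' : ∀ i j, i ≤ j → ∫ ω, (∑ m ∈ Finset.Ico i j, ξ' m ω) ^ 2 ∂P ≤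
      K * ∑ m ∈ Finset.Ico i j, a' m := by
    intro i j hij
    simp only [hξ', ha']
    simp only [htrunc a, fun ω => htrunc (fun m => ξ m ω)]
    rcases le_total i M with h | h
    · exact hE i _ (le_min hij h) (min_le_right _ _)
    · rw [Finset.Ico_eq_empty_of_le ((min_le_right _ _).trans h)]
      simp
  -- Levels are the integer parts of `log (S' 0 / S' m)`, and `rep` picks the first index of a
  -- level. All other indices of the level lie to its right, so `T m` is `T` at the representative
  -- minus a partial sum started there.
  set lev : ℕ → ℕ := fun m => ⌊Real.log (S' 0 / S' m)⌋₊ with hlev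
  set rep : ℕ → ℕ := fun g => sInf {m | m < M ∧ 0 < S' m ∧ lev m = g} with hrep
  have hrepm : ∀ m < M, 0 < S' m → rep (lev m) ≤ m ∧ rep (lev m) < M ∧ 0 < S' (rep (lev m)) ∧
      lev (rep (lev m)) = lev m := fun m hm hp =>
    ⟨Nat.sInf_le (show m ∈ {i | i < M ∧ 0 < S' i ∧ lev i = lev m} from ⟨hm, hp, rfl⟩),
      Nat.sInf_mem (s := {i | i < M ∧ 0 < S' i ∧ lev i = lev m}) ⟨m, hm, hp, rfl⟩⟩
  set D : ℕ → Ω → ℝ := fun i ω => dyadicEnergy (fun m => ξ' m ω) r i with hD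
  set Y : Ω → ℕ → ℝ := fun ω g => 2 * T (rep g) ω ^ 2 + 2 * ((r + 1) * D (rep g) ω) with hY
  set G := ((Finset.range M).filter fun m => 0 < S' m).image lev with hG
  have hGmem : ∀ g ∈ G, rep g < M ∧ 0 < S' (rep g) := by
    intro g hg
    obtain ⟨m, hm, rfl⟩ := Finset.mem_image.1 hg
    obtain ⟨hm1, hm2⟩ := Finset.mem_filter.1 hm
    exact ⟨(hrepm m (Finset.mem_range.1 hm1) hm2).2.1, (hrepm m (Finset.mem_range.1 hm1) hm2).2.2.1⟩
  have hcard1 : (G.card : ℝ) ≤ M := by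
    have : G.card ≤ M :=
      Finset.card_image_le.trans ((Finset.card_filter_le _ _).trans (Finset.card_range M).le)
    exact_mod_cast this
  set B := ∑ j ∈ Finset.Icc 1 N, (S (j - 1) - S j) / (4 * S j) with hB
  have hterm : ∀ j ∈ Finset.Icc 1 N, (S' (j - 1) - S' j) / S' j =
      4 * ((S (j - 1) - S j) / (4 * S j)) ∧ 0 ≤ (S' (j - 1) - S' j) / S' j := by
    intro j hj
    obtain ⟨hj1, hj2⟩ := Finset.mem_Icc.1 hj
    refine ⟨?_, div_nonneg (sub_nonneg.2 (hanti (Nat.sub_le _ _))) (hS0 j)⟩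
    rw [hSS j (by omega), hSS (j - 1) (by omega)]
    -- A vanishing tail makes both quotients zero, by the convention for division by zero.
    by_cases h : S' j = 0
    · simp [h]
    · field_simp
  have hB4 : ∑ j ∈ Finset.Icc 1 N, (S' (j - 1) - S' j) / S' j = 4 * B := by
    rw [hB, Finset.mul_sum]
    exact Finset.sum_congr rfl fun j hj => (hterm j hj).1
  have hB0 : 0 ≤ B := by
    have := Finset.sum_nonneg fun j hj => (hterm j hj).2
    linarith
  have hcard2 : (G.card : ℝ) ≤ 4 * (1 + B) := by
    have hsub : G ⊆ Finset.range (⌊4 * B⌋₊ + 1) := by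
      intro g hg
      obtain ⟨m, hm, rfl⟩ := Finset.mem_image.1 hg
      obtain ⟨hm1, hm2⟩ := Finset.mem_filter.1 hm
      have hmM := Finset.mem_range.1 hm1
      refine Finset.mem_range.2 (Nat.lt_succ_of_le (Nat.floor_le_floor ?_))
      refine (log_div_le_sum S' hanti m hm2).trans ?_
      rw [← hB4]
      refine Finset.sum_le_sum_of_subset_of_nonneg (Finset.Icc_subset_Icc le_rfl ?_)
        fun j hj _ => (hterm j hj).2
      exact hN m hmM (by rwa [hSS m hmM.le])
    have h1 := Finset.card_le_card hsub
    rw [Finset.card_range] at h1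
    have h2 : (G.card : ℝ) ≤ ⌊4 * B⌋₊ + 1 := by exact_mod_cast h1
    have h3 := Nat.floor_le (show 0 ≤ 4 * B by positivity)
    linarith
  have hDint : ∀ i, Integrable (D i) P := fun i => integrable_dyadicEnergy hξL r i
  have hYint : ∀ g, Integrable (fun ω => Y ω g) P := fun g =>
    ((hTL (rep g)).integrable_sq.const_mul 2).add (((hDint (rep g)).const_mul _).const_mul _)
  have hY0 : ∀ ω g, 0 ≤ Y ω g := by
    intro ω g
    have := dyadicEnergy_nonneg (fun m => ξ' m ω) r (rep g)
    simp only [hY, hD]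
    positivity
  -- One factor `r + 1` comes from the pathwise maximal inequality and one from the expected energy;
  -- the term with `T` at the representative is absorbed in the constant.
  have hYE : ∀ g ∈ G, ∫ ω, Y ω g ∂P ≤ 4 * (r + 1) ^ 2 * (K * S' (rep g)) := by
    intro g hg
    simp only [hY]
    rw [integral_add ((hTL (rep g)).integrable_sq.const_mul 2)
      (((hDint (rep g)).const_mul _).const_mul _), integral_const_mul, integral_const_mul,
      integral_const_mul]
    have h1 := hTE (rep g) (hGmem g hg).1.le
    have h2 := integral_dyadicEnergy_le hξL hE' r (rep g)
    have h3 : ∑ m ∈ Finset.Ico (rep g) (rep g + 2 ^ r), a' m = S' (rep g) := by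
      simp only [ha', htrunc a]
      rw [min_eq_right (hMr.trans (Nat.le_add_left _ _))]
    rw [h3] at h2
    have h4 : 0 ≤ K * S' (rep g) := mul_nonneg hK (hS0 _)
    have h5 := mul_le_mul_of_nonneg_left h2 (show (0 : ℝ) ≤ r + 1 by positivity)
    have h6 : (1 : ℝ) ≤ (r + 1) ^ 2 := one_le_pow₀ (by linarith [Nat.cast_nonneg (α := ℝ) r])
    nlinarith
  refine ⟨fun ω => ∑ g ∈ G, Y ω g / S' (rep g) * 3, ?_, ?_, ?_, ?_⟩
  · exact integrable_finsetSum _ fun g _ => ((hYint g).div_const _).mul_const _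
  · exact fun ω => Finset.sum_nonneg fun g _ =>
      mul_nonneg (div_nonneg (hY0 ω g) (hS0 _)) (by norm_num)
  · rw [integral_finsetSum _ fun g _ => ((hYint g).div_const _).mul_const _]
    have h1 : ∀ g ∈ G, ∫ ω, Y ω g / S' (rep g) * 3 ∂P ≤ 12 * (r + 1) ^ 2 * K := by
      intro g hg
      rw [integral_mul_const, integral_div]
      have h2 := hYE g hg
      have h3 := (hGmem g hg).2
      have h4 : (∫ ω, Y ω g ∂P) / S' (rep g) ≤ 4 * (r + 1) ^ 2 * K := by
        rw [div_le_iff₀ h3]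
        linarith
      linarith
    refine (Finset.sum_le_card_nsmul _ _ _ h1).trans ?_
    rw [nsmul_eq_mul]
    have h2 : (r : ℝ) + 1 ≤ 2 * (1 + Real.log M) := by
      rw [hr]
      push_cast
      linarith [natLog_two_add_two_le hM]
    have h3 : ((r : ℝ) + 1) ^ 2 ≤ (2 * (1 + Real.log M)) ^ 2 :=
      pow_le_pow_left₀ (by positivity) h2 2
    have h4 : (G.card : ℝ) ≤ 4 * min (M : ℝ) (1 + B) := by
      have := le_min (show (G.card : ℝ) / 4 ≤ M by linarith [Nat.cast_nonneg (α := ℝ) M])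
        (show (G.card : ℝ) / 4 ≤ 1 + B by linarith)
      linarith
    -- The constant is `192 = 4 * 12 * 2²`: number of levels, cost of one level, and `r + 1` against
    -- `1 + log M`.
    calc (G.card : ℝ) * (12 * (r + 1) ^ 2 * K)
        ≤ (4 * min (M : ℝ) (1 + B)) * (12 * (2 * (1 + Real.log M)) ^ 2 * K) := by
          gcongr
      _ = _ := by ring
  -- A zero tail of `a` forces the second moment of `T m` to vanish, so `T m = 0` almost surely.
  -- Only finitely many `m` occur, so the exceptional set does not depend on `x`.
  · have hae : ∀ᵐ ω ∂P, ∀ m ∈ Finset.range M, S' m = 0 → T m ω = 0 := by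
      rw [Finset.eventually_all]
      intro m hm
      by_cases h : S' m = 0
      · have h1 : ∫ ω, T m ω ^ 2 ∂P = 0 := by
          refine le_antisymm ?_ (integral_nonneg fun ω => sq_nonneg _)
          simpa [h] using hTE m (Finset.mem_range.1 hm).le
        rw [integral_eq_zero_iff_of_nonneg (fun ω => sq_nonneg _) (hTL m).integrable_sq] at h1
        filter_upwards [h1] with ω hω _
        simpa using hω
      · exact Filter.Eventually.of_forall fun ω h' => absurd h' h
    filter_upwards [hae] with ω hω x hx hx0
    refine sq_sum_monotone_mul_le M (fun m => ξ m ω) a x ha hx hx0 lev (Y ω)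
      (fun g => S' (rep g)) 3 (fun m hm => hω m (Finset.mem_range.2 hm)) ?_ ?_
    · intro m hm hp
      obtain ⟨h1, h2, h3, h4⟩ := hrepm m hm hp
      have h5 : T (rep (lev m)) ω = ∑ l ∈ Finset.Ico (rep (lev m)) m, ξ l ω + T m ω :=
        (Finset.sum_Ico_consecutive (fun l => ξ l ω) h1 hm.le).symm
      have h6 : ∑ l ∈ Finset.Ico (rep (lev m)) m, ξ l ω =
          ∑ l ∈ Finset.Ico (rep (lev m)) (rep (lev m) + (m - rep (lev m))), ξ' l ω := by
        rw [Nat.add_sub_cancel' h1]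
        refine Finset.sum_congr rfl fun l hl => ?_
        rw [hξ']
        simp only [if_pos ((Finset.mem_Ico.1 hl).2.trans hm)]
      have h7 := sq_partialSum_le_dyadicEnergy (fun m => ξ' m ω) r (rep (lev m))
        (m - rep (lev m)) ((Nat.sub_le _ _).trans (hm.le.trans hMr))
      rw [← h6] at h7
      have h8 : T m ω = T (rep (lev m)) ω - ∑ l ∈ Finset.Ico (rep (lev m)) m, ξ l ω := by
        rw [h5]; ring
      change T m ω ^ 2 ≤ 2 * T (rep (lev m)) ω ^ 2 + 2 * ((r + 1) * D (rep (lev m)) ω)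
      rw [h8]
      have h9 := sq_nonneg (T (rep (lev m)) ω + ∑ l ∈ Finset.Ico (rep (lev m)) m, ξ l ω)
      linarith
    · intro m hm hp
      obtain ⟨h1, h2, h3, h4⟩ := hrepm m hm hp
      refine ⟨h3, ?_⟩
      change S' (rep (lev m)) ≤ 3 * S' m
      replace hp : 0 < S' m := hp
      have h0 : 0 < S' 0 := hp.trans_le (hanti (Nat.zero_le _))
      set m0 := rep (lev m)
      have hl0 : (lev m0 : ℝ) ≤ Real.log (S' 0 / S' m0) :=
        Nat.floor_le (Real.log_nonneg ((one_le_div h3).2 (hanti (Nat.zero_le _))))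
      have hl1 : Real.log (S' 0 / S' m) < lev m + 1 := Nat.lt_floor_add_one _
      rw [h4] at hl0
      rw [Real.log_div h0.ne' h3.ne'] at hl0
      rw [Real.log_div h0.ne' hp.ne'] at hl1
      -- Equal integer parts differ by less than one before rounding, so the tails on a level differ
      -- by a factor below `e < 3`.
      have h5 : Real.log (S' m0 / S' m) < 1 := by
        rw [Real.log_div h3.ne' hp.ne']
        linarith
      rw [Real.log_lt_iff_lt_exp (by positivity), div_lt_iff₀ hp] at h5
      have h6 : Real.exp 1 < 3 := by linarith [Real.exp_one_lt_d9]
      nlinarith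


/-! ### Moments of linear and quadratic forms in independent errors -/

section
variable {Ω : Type*} [MeasurableSpace Ω] {P : Measure Ω}

theorem pow_four_le_exp_add_exp (x : ℝ) : x ^ 4 ≤ 24 * (Real.exp x + Real.exp (-x)) := by
  have key : ∀ y : ℝ, 0 ≤ y → y ^ 4 ≤ 24 * Real.exp y := by
    intro y hy
    have := Real.pow_div_factorial_le_exp y hy 4
    have h4 : ((Nat.factorial 4 : ℕ) : ℝ) = 24 := by norm_num [Nat.factorial]
    rw [h4, div_le_iff₀ (by norm_num)] at this
    linarith
  rcases le_total 0 x with h | h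
  · linarith [key x h, Real.exp_pos (-x)]
  · have := key (-x) (by linarith)
    have h2 : (-x) ^ 4 = x ^ 4 := by ring
    linarith [Real.exp_pos x]

/-- The fourth power is dominated by exponentials at the scale `1 / η`, where the sub-Gaussian bound
is at most `e < 3`; the constant is `24 * (3 + 3)`. The case `η = 0` is separate because that scale
does not exist. -/
theorem integral_pow_four_le {X : Ω → ℝ} {η : NNReal} (h : HasSubgaussianMGF X (η ^ 2) P) :
    ∫ ω, X ω ^ 4 ∂P ≤ 144 * (η : ℝ) ^ 4 := by
  by_cases hη : η = 0
  · subst hη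
    have h0 : X =ᵐ[P] 0 := by
      refine HasSubgaussianMGF.ae_eq_zero_of_hasSubgaussianMGF_zero ?_
      simpa using h
    have : (fun ω => X ω ^ 4) =ᵐ[P] fun _ => 0 := by
      filter_upwards [h0] with ω hω
      simp [hω]
    rw [integral_congr_ae this]
    simp
  · have hη' : 0 < (η : ℝ) := by positivity
    set t : ℝ := (η : ℝ)⁻¹ with ht
    have hb : ∀ u : ℝ, u ^ 2 = t ^ 2 → ∫ ω, Real.exp (u * X ω) ∂P ≤ Real.exp 1 := by
      intro u hu
      refine (h.mgf_le u).trans ?_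
      apply Real.exp_le_exp.2
      rw [hu, ht]
      push_cast
      rw [inv_pow, mul_inv_cancel₀ (by positivity)]
      norm_num
    have hi1 := h.integrable_exp_mul t
    have hi2 := h.integrable_exp_mul (-t)
    have h4 : ∫ ω, X ω ^ 4 ∂P ≤
        ∫ ω, (η : ℝ) ^ 4 * (24 * (Real.exp (t * X ω) + Real.exp (-t * X ω))) ∂P := by
      refine integral_mono_of_nonneg (Filter.Eventually.of_forall fun ω => by positivity)
        (((hi1.add hi2).const_mul 24).const_mul _) (Filter.Eventually.of_forall fun ω => ?_)
      have := pow_four_le_exp_add_exp (t * X ω)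
      have h5 : X ω ^ 4 = (η : ℝ) ^ 4 * (t * X ω) ^ 4 := by
        rw [ht]; field_simp
      dsimp only
      rw [h5, neg_mul]
      exact mul_le_mul_of_nonneg_left this (by positivity)
    refine h4.trans ?_
    rw [integral_const_mul, integral_const_mul, integral_add hi1 hi2]
    have h1 := hb t rfl
    have h2 := hb (-t) (by ring)
    have h3 : Real.exp 1 < 3 := by linarith [Real.exp_one_lt_d9]
    have h6 : (0 : ℝ) ≤ η ^ 4 := by positivity
    nlinarith

theorem memLp_mul_of_memLp_four {f g : Ω → ℝ} (hf : MemLp f 4 P) (hg : MemLp g 4 P) :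
    MemLp (fun ω => f ω * g ω) 2 P := by
  have : ENNReal.HolderTriple 4 4 2 := ⟨by
    rw [show (4 : ENNReal) = 2 * 2 by norm_num, ENNReal.mul_inv (by simp) (by simp),
      ← mul_add, ENNReal.inv_two_add_inv_two, mul_one]⟩
  exact hg.mul hf

variable [IsProbabilityMeasure P] {n : ℕ} {ε : Fin n → Ω → ℝ}

omit [IsProbabilityMeasure P] in
theorem indepFun_comp_finset (hind : iIndepFun ε P) (hm : ∀ i, AEMeasurable (ε i) P)
    {a : Fin n} {s : Finset (Fin n)} (ha : a ∉ s) {u : ℝ → ℝ} (hu : Measurable u)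
    {v : (s → ℝ) → ℝ} (hv : Measurable v) :
    IndepFun (fun ω => u (ε a ω)) (fun ω => v fun i => ε i ω) P := by
  have h1 := hind.indepFun_finset₀ {a} s (Finset.disjoint_singleton_left.2 ha) hm
  have h2 : Measurable fun w : ({a} : Finset (Fin n)) → ℝ =>
      u (w ⟨a, Finset.mem_singleton_self a⟩) := hu.comp (measurable_pi_apply _)
  exact h1.comp h2 hv

/-- The errors are added one at a time: the new one is centred and independent of the rest, so the
cross term integrates to zero. -/
theorem integral_sq_linear {σ : ℝ} (hind : iIndepFun ε P) (h4 : ∀ i, MemLp (ε i) 4 P)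
    (h0 : ∀ i, ∫ ω, ε i ω ∂P = 0) (h2 : ∀ i, ∫ ω, ε i ω ^ 2 ∂P = σ ^ 2)
    (v : Fin n → ℝ) (s : Finset (Fin n)) :
    ∫ ω, (∑ i ∈ s, v i * ε i ω) ^ 2 ∂P = σ ^ 2 * ∑ i ∈ s, v i ^ 2 := by
  have hL2 : ∀ i, MemLp (ε i) 2 P := fun i => (h4 i).mono_exponent (by norm_num)
  have hm : ∀ i, AEMeasurable (ε i) P := fun i => (h4 i).aemeasurable
  have hG : ∀ s : Finset (Fin n), MemLp (fun ω => ∑ i ∈ s, v i * ε i ω) 2 P :=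
    fun s => memLp_finsetSum _ fun i _ => (hL2 i).const_mul (v i)
  induction s using Finset.induction_on with
  | empty => simp
  | insert a s ha ih =>
    have hI : IndepFun (fun ω => ε a ω) (fun ω => ∑ i ∈ s, v i * ε i ω) P := by
      have := indepFun_comp_finset hind hm ha measurable_id
        (v := fun w => ∑ i : s, v i * w i) (by fun_prop)
      simpa only [id, fun ω => Finset.sum_coe_sort s fun i => v i * ε i ω] using this
    have e : ∀ ω, (∑ i ∈ insert a s, v i * ε i ω) ^ 2 = v a ^ 2 * ε a ω ^ 2 +
        (2 * v a * (ε a ω * ∑ i ∈ s, v i * ε i ω) + (∑ i ∈ s, v i * ε i ω) ^ 2) := by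
      intro ω
      rw [Finset.sum_insert ha]
      ring
    have i1 : Integrable (fun ω => v a ^ 2 * ε a ω ^ 2) P := (hL2 a).integrable_sq.const_mul _
    have i2 : Integrable (fun ω => 2 * v a * (ε a ω * ∑ i ∈ s, v i * ε i ω)) P :=
      ((hL2 a).integrable_mul (hG s)).const_mul _
    have i3 : Integrable (fun ω => (∑ i ∈ s, v i * ε i ω) ^ 2) P := (hG s).integrable_sq
    simp only [e]
    rw [integral_add i1 (by exact i2.add i3), integral_add i2 i3, integral_const_mul, integral_const_mul,
      hI.integral_fun_mul_eq_mul_integral (hL2 a).1 (hG s).1, h0 a, ih, h2 a,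
      Finset.sum_insert ha]
    ring

theorem integral_linear (h4 : ∀ i, MemLp (ε i) 4 P) (h0 : ∀ i, ∫ ω, ε i ω ∂P = 0)
    (v : Fin n → ℝ) (s : Finset (Fin n)) : ∫ ω, ∑ i ∈ s, v i * ε i ω ∂P = 0 := by
  have hL1 : ∀ i, Integrable (ε i) P := fun i => (h4 i).integrable (by norm_num)
  rw [integral_finsetSum _ fun i _ => (hL1 i).const_mul _]
  simp [integral_const_mul, h0]

/-- The centred quadratic form of the errors with indices in `s`. -/
noncomputable def centredQuad (A : Matrix (Fin n) (Fin n) ℝ) (σ : ℝ) (ε : Fin n → Ω → ℝ)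
    (s : Finset (Fin n)) (ω : Ω) : ℝ :=
  ∑ i ∈ s, ∑ j ∈ s, A i j * (ε i ω * ε j ω) - σ ^ 2 * ∑ i ∈ s, A i i

theorem memLp_centredQuad (h4 : ∀ i, MemLp (ε i) 4 P) (A : Matrix (Fin n) (Fin n) ℝ) (σ : ℝ)
    (s : Finset (Fin n)) : MemLp (centredQuad A σ ε s) 2 P :=
  (memLp_finsetSum _ fun i _ => memLp_finsetSum _ fun j _ =>
    (memLp_mul_of_memLp_four (h4 i) (h4 j)).const_mul _).sub (memLp_const _)

omit [MeasurableSpace Ω] in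
theorem centredQuad_insert {A : Matrix (Fin n) (Fin n) ℝ} (hA : Aᵀ = A) (σ : ℝ) {a : Fin n}
    {s : Finset (Fin n)} (ha : a ∉ s) (ω : Ω) :
    centredQuad A σ ε (insert a s) ω = centredQuad A σ ε s ω +
      (A a a * (ε a ω ^ 2 - σ ^ 2) + ε a ω * ∑ j ∈ s, (2 * A a j) * ε j ω) := by
  have h1 : ∀ i, A i a = A a i := fun i => congrFun (congrFun hA a) i
  simp only [centredQuad, Finset.sum_insert ha, Finset.sum_add_distrib, h1]
  rw [Finset.mul_sum s fun j => 2 * A a j * ε j ω]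
  have h2 : ∑ j ∈ s, ε a ω * (2 * A a j * ε j ω) =
      ∑ j ∈ s, A a j * (ε a ω * ε j ω) + ∑ j ∈ s, A a j * (ε j ω * ε a ω) := by
    rw [← Finset.sum_add_distrib]
    exact Finset.sum_congr rfl fun j _ => by ring
  rw [h2]
  ring

/-- Adding the index `a` changes the form by an increment that is uncorrelated with the previous
form, as in a martingale. Second moments therefore add, and the increment is controlled by the new
row of `A`, so the Frobenius norm accumulates. -/
theorem integral_centredQuad {σ : ℝ} (hind : iIndepFun ε P) (h4 : ∀ i, MemLp (ε i) 4 P)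
    (h0 : ∀ i, ∫ ω, ε i ω ∂P = 0) (h2 : ∀ i, ∫ ω, ε i ω ^ 2 ∂P = σ ^ 2)
    {A : Matrix (Fin n) (Fin n) ℝ} (hA : Aᵀ = A) {m : ℝ} (hm4 : ∀ i, ∫ ω, ε i ω ^ 4 ∂P ≤ m)
    (s : Finset (Fin n)) :
    ∫ ω, centredQuad A σ ε s ω ∂P = 0 ∧
    ∫ ω, centredQuad A σ ε s ω ^ 2 ∂P ≤
      (2 * m + 8 * σ ^ 4) * ∑ i ∈ s, ∑ j ∈ s, A i j ^ 2 := by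
  have hL2 : ∀ i, MemLp (ε i) 2 P := fun i => (h4 i).mono_exponent (by norm_num)
  have hm : ∀ i, AEMeasurable (ε i) P := fun i => (h4 i).aemeasurable
  induction s using Finset.induction_on with
  | empty => simp [centredQuad]
  | insert a s ha ih =>
    have hm0 : 0 ≤ m := (integral_nonneg fun ω => by positivity).trans (hm4 a)
    set G : Ω → ℝ := fun ω => ∑ j ∈ s, (2 * A a j) * ε j ω with hG
    set Q := centredQuad A σ ε s with hQ
    have hGL4 : MemLp G 4 P := memLp_finsetSum _ fun i _ => (h4 i).const_mul _
    have hGL : MemLp G 2 P := hGL4.mono_exponent (by norm_num)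
    have hQL : MemLp Q 2 P := memLp_centredQuad h4 A σ s
    have hsqL : MemLp (fun ω => ε a ω ^ 2 - σ ^ 2) 2 P := by
      have := (memLp_mul_of_memLp_four (h4 a) (h4 a)).sub (memLp_const (μ := P) (p := 2) (σ ^ 2))
      simpa [pow_two, Pi.sub_def] using this
    have heGL : MemLp (fun ω => ε a ω * G ω) 2 P := memLp_mul_of_memLp_four (h4 a) hGL4
    have hvG : Measurable fun w : s → ℝ => ∑ j : s, (2 * A a j) * w j := by fun_prop
    have hvQ : Measurable fun w : s → ℝ =>
      ∑ i : s, ∑ j : s, A i j * (w i * w j) - σ ^ 2 * ∑ i ∈ s, A i i := by fun_prop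
    have eG : ∀ ω, ∑ j : s, (2 * A a j) * ε j ω = G ω := fun ω =>
      Finset.sum_coe_sort s fun j => (2 * A a j) * ε j ω
    have eQ : ∀ ω, ∑ i : s, ∑ j : s, A i j * (ε i ω * ε j ω) - σ ^ 2 * ∑ i ∈ s, A i i = Q ω := by
      intro ω
      rw [hQ, centredQuad, ← Finset.sum_coe_sort s fun i => ∑ j ∈ s, A i j * (ε i ω * ε j ω)]
      congr 1
      exact Finset.sum_congr rfl fun i _ =>
        Finset.sum_coe_sort s fun j => A i j * (ε i ω * ε j ω)
    have hI1 : IndepFun (fun ω => ε a ω) G P := by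
      have := indepFun_comp_finset hind hm ha measurable_id hvG
      simpa only [eG, id] using this
    have hI2 : IndepFun (fun ω => ε a ω ^ 2) (fun ω => G ω ^ 2) P := by
      have := indepFun_comp_finset hind hm ha (measurable_id.pow_const 2) (hvG.pow_const 2)
      simpa only [eG, id, Pi.pow_apply] using this
    have hI3 : IndepFun (fun ω => ε a ω ^ 2 - σ ^ 2) Q P := by
      have := indepFun_comp_finset hind hm ha ((measurable_id.pow_const 2).sub_const (σ ^ 2)) hvQ
      simpa only [eQ, id, Pi.pow_apply] using this
    have hI4 : IndepFun (fun ω => ε a ω) (fun ω => G ω * Q ω) P := by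
      have := indepFun_comp_finset hind hm ha measurable_id (hvG.mul hvQ)
      simpa only [eG, eQ, id, Pi.mul_apply] using this
    have hsq0 : ∫ ω, (ε a ω ^ 2 - σ ^ 2) ∂P = 0 := by
      rw [integral_sub (hL2 a).integrable_sq (integrable_const _), h2 a]
      simp
    have heG0 : ∫ ω, ε a ω * G ω ∂P = 0 := by
      rw [hI1.integral_fun_mul_eq_mul_integral (hL2 a).1 hGL.1, h0 a, zero_mul]
    have hsqQ : ∫ ω, (ε a ω ^ 2 - σ ^ 2) * Q ω ∂P = 0 := by
      rw [hI3.integral_fun_mul_eq_mul_integral hsqL.1 hQL.1, hsq0, zero_mul]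
    have heGQ : ∫ ω, ε a ω * (G ω * Q ω) ∂P = 0 := by
      rw [hI4.integral_fun_mul_eq_mul_integral (hL2 a).1 (hGL.1.mul hQL.1), h0 a, zero_mul]
    have heG2 : ∫ ω, (ε a ω * G ω) ^ 2 ∂P = 4 * σ ^ 4 * ∑ j ∈ s, A a j ^ 2 := by
      simp only [mul_pow]
      rw [hI2.integral_fun_mul_eq_mul_integral (hL2 a).integrable_sq.1 hGL.integrable_sq.1, h2 a,
        hG, integral_sq_linear hind h4 h0 h2]
      simp only [mul_pow, ← Finset.mul_sum]
      ring
    have hsq2 : ∫ ω, (ε a ω ^ 2 - σ ^ 2) ^ 2 ∂P ≤ m := by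
      -- Arranged so that the middle term has mean zero, leaving the fourth moment minus `σ ^ 4`.
      have e : ∀ ω, (ε a ω ^ 2 - σ ^ 2) ^ 2 =
          ε a ω ^ 4 + (-(2 * σ ^ 2) * (ε a ω ^ 2 - σ ^ 2) + -σ ^ 4) := fun ω => by ring
      have i4 : Integrable (fun ω => ε a ω ^ 4) P := by
        have := (memLp_mul_of_memLp_four (h4 a) (h4 a)).integrable_sq
        refine this.congr (Filter.Eventually.of_forall fun ω => ?_)
        dsimp only
        ring
      have i5 : Integrable (fun ω => -(2 * σ ^ 2) * (ε a ω ^ 2 - σ ^ 2)) P :=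
        (hsqL.integrable (by norm_num)).const_mul _
      simp only [e]
      rw [integral_add i4 (by exact i5.add (integrable_const _)), integral_add i5 (integrable_const _),
        integral_const_mul, hsq0]
      simp only [integral_const, probReal_univ, smul_eq_mul]
      nlinarith [hm4 a, sq_nonneg (σ ^ 2)]
    have hRL : MemLp (fun ω => A a a * (ε a ω ^ 2 - σ ^ 2) + ε a ω * G ω) 2 P :=
      (hsqL.const_mul _).add heGL
    have hR2 : ∫ ω, (A a a * (ε a ω ^ 2 - σ ^ 2) + ε a ω * G ω) ^ 2 ∂P ≤
        2 * A a a ^ 2 * m + 8 * σ ^ 4 * ∑ j ∈ s, A a j ^ 2 := by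
      have h5 : ∫ ω, (A a a * (ε a ω ^ 2 - σ ^ 2) + ε a ω * G ω) ^ 2 ∂P ≤
          ∫ ω, (2 * A a a ^ 2 * (ε a ω ^ 2 - σ ^ 2) ^ 2 + 2 * (ε a ω * G ω) ^ 2) ∂P := by
        refine integral_mono hRL.integrable_sq
          ((hsqL.integrable_sq.const_mul _).add (heGL.integrable_sq.const_mul _)) fun ω => ?_
        dsimp only
        nlinarith [sq_nonneg (A a a * (ε a ω ^ 2 - σ ^ 2) - ε a ω * G ω)]
      refine h5.trans ?_
      rw [integral_add (hsqL.integrable_sq.const_mul _) (heGL.integrable_sq.const_mul _),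
        integral_const_mul, integral_const_mul, heG2]
      have := mul_le_mul_of_nonneg_left hsq2 (show 0 ≤ 2 * A a a ^ 2 by positivity)
      linarith
    refine ⟨?_, ?_⟩
    · simp only [centredQuad_insert hA σ ha]
      rw [integral_add (hQL.integrable (by norm_num)) (hRL.integrable (by norm_num)), ih.1,
        integral_add ((hsqL.integrable (by norm_num)).const_mul _)
          (heGL.integrable (by norm_num)), integral_const_mul, hsq0, heG0]
      simp
    · have e : ∀ ω, centredQuad A σ ε (insert a s) ω ^ 2 = Q ω ^ 2 +
          ((A a a * (ε a ω ^ 2 - σ ^ 2) + ε a ω * G ω) ^ 2 +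
            (2 * A a a * ((ε a ω ^ 2 - σ ^ 2) * Q ω) + 2 * (ε a ω * (G ω * Q ω)))) := by
        intro ω
        rw [centredQuad_insert hA σ ha]
        ring
      have i1 : Integrable (fun ω => Q ω ^ 2) P := hQL.integrable_sq
      have i2 : Integrable (fun ω => (A a a * (ε a ω ^ 2 - σ ^ 2) + ε a ω * G ω) ^ 2) P :=
        hRL.integrable_sq
      have i3 : Integrable (fun ω => 2 * A a a * ((ε a ω ^ 2 - σ ^ 2) * Q ω)) P :=
        (hsqL.integrable_mul hQL).const_mul _
      have i4 : Integrable (fun ω => 2 * (ε a ω * (G ω * Q ω))) P := by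
        have := (heGL.integrable_mul hQL).const_mul 2
        refine this.congr (Filter.Eventually.of_forall fun ω => ?_)
        simp only [Pi.mul_apply]
        ring
      simp only [e]
      rw [integral_add i1 (by exact i2.add (i3.add i4)), integral_add i2 (by exact i3.add i4), integral_add i3 i4,
        integral_const_mul, integral_const_mul, hsqQ, heGQ]
      have hsum : ∑ i ∈ insert a s, ∑ j ∈ insert a s, A i j ^ 2 =
          A a a ^ 2 + 2 * ∑ j ∈ s, A a j ^ 2 + ∑ i ∈ s, ∑ j ∈ s, A i j ^ 2 := by
        have h1 : ∀ i, A i a = A a i := fun i => congrFun (congrFun hA a) i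
        simp only [Finset.sum_insert ha, Finset.sum_add_distrib, h1]
        ring
      rw [hsum]
      have h6 := ih.2
      have h7 : 0 ≤ ∑ j ∈ s, A a j ^ 2 := Finset.sum_nonneg fun j _ => sq_nonneg _
      have h8 : 0 ≤ σ ^ 4 := by positivity
      nlinarith [mul_nonneg hm0 h7, mul_nonneg h8 h7, mul_nonneg h8 (sq_nonneg (A a a))]

end

/-! ### Diagonalization in the nested basis and reduction to blocks -/

theorem sqNorm_eq_dotProduct {n : ℕ} (v : Fin n → ℝ) : sqNorm v = v ⬝ᵥ v :=
  Finset.sum_congr rfl fun i _ => sq (v i)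

theorem sqNorm_sub {n : ℕ} (u v : Fin n → ℝ) :
    sqNorm (u - v) = sqNorm u - 2 * (u ⬝ᵥ v) + sqNorm v := by
  simp only [sqNorm_eq_dotProduct, sub_dotProduct, dotProduct_sub, dotProduct_comm v u]
  ring

section
variable {n p : ℕ} {X : Matrix (Fin n) (Fin p) ℝ} {φ : Fin p → Fin n → ℝ}

theorem firstIdx_mono {j k : ℕ} (h : j ≤ k) : firstIdx p j ⊆ firstIdx p k := by
  intro a
  simp only [firstIdx, Finset.mem_filter, Finset.mem_univ, true_and]
  omega

theorem IsNestedBasis.dotProduct_self (hφ : IsNestedBasis X φ) (j : Fin p) : φ j ⬝ᵥ φ j = 1 := by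
  rw [← sqNorm_eq_dotProduct]
  exact (hφ j).1

/-- Increments of a nested chain of projections annihilate each other, and the trace of the product
of the two rank-one increments is the square of the inner product. -/
theorem IsNestedBasis.dotProduct_eq_zero_of_lt (hX : LinearIndependent ℝ X.col)
    (hφ : IsNestedBasis X φ) {i j : Fin p} (hij : i < j) : φ i ⬝ᵥ φ j = 0 := by
  have hij' : (i : ℕ) < j := hij
  have h : vecMulVec (φ i) (φ i) * vecMulVec (φ j) (φ j) = 0 := by
    rw [← (hφ i).2, ← (hφ j).2, Matrix.sub_mul, Matrix.mul_sub, Matrix.mul_sub,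
      projMatrix_mul_of_subset' X hX (firstIdx_mono (show (i : ℕ) + 1 ≤ j + 1 by omega)),
      projMatrix_mul_of_subset' X hX (firstIdx_mono (show (i : ℕ) + 1 ≤ j by omega)),
      projMatrix_mul_of_subset' X hX (firstIdx_mono (show (i : ℕ) ≤ j + 1 by omega)),
      projMatrix_mul_of_subset' X hX (firstIdx_mono (show (i : ℕ) ≤ j by omega))]
    simp
  rw [Matrix.vecMulVec_mul_vecMulVec] at h
  have h2 := congrArg Matrix.trace h
  rw [Matrix.trace_zero, Matrix.trace_vecMulVec, dotProduct_smul, smul_eq_mul] at h2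
  exact mul_self_eq_zero.1 h2

theorem IsNestedBasis.dotProduct_eq (hX : LinearIndependent ℝ X.col) (hφ : IsNestedBasis X φ)
    (i j : Fin p) : φ i ⬝ᵥ φ j = if i = j then 1 else 0 := by
  split_ifs with h
  · rw [h, hφ.dotProduct_self]
  · rcases lt_or_gt_of_ne h with h | h
    · exact hφ.dotProduct_eq_zero_of_lt hX h
    · rw [dotProduct_comm]
      exact hφ.dotProduct_eq_zero_of_lt hX h

theorem IsNestedBasis.projMatrix_firstIdx (hφ : IsNestedBasis X φ) (k : ℕ) :
    projMatrix X (firstIdx p k) =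
      ∑ l : Fin p, if (l : ℕ) < k then vecMulVec (φ l) (φ l) else 0 := by
  induction k with
  | zero =>
    have : firstIdx p 0 = ∅ := by simp [firstIdx]
    rw [this]
    ext a b
    simp [projMatrix, Matrix.mul_apply]
  | succ k ih =>
    by_cases hk : k < p
    · have h := (hφ ⟨k, hk⟩).2
      rw [sub_eq_iff_eq_add] at h
      dsimp only at h
      rw [h, ih]
      have h2 : vecMulVec (φ ⟨k, hk⟩) (φ ⟨k, hk⟩) =
          ∑ l : Fin p, if l = ⟨k, hk⟩ then vecMulVec (φ l) (φ l) else 0 := by simp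
      rw [h2, ← Finset.sum_add_distrib]
      refine Finset.sum_congr rfl fun l _ => ?_
      rcases lt_trichotomy (l : ℕ) k with h3 | h3 | h3
      · have h4 : l ≠ ⟨k, hk⟩ := fun h => by simp [h] at h3
        simp [h4, h3, Nat.lt_succ_of_lt h3]
      · have h4 : l = ⟨k, hk⟩ := Fin.ext h3
        simp [h4]
      · have h4 : l ≠ ⟨k, hk⟩ := fun h => by simp [h] at h3
        have h5 : ¬ (l : ℕ) < k + 1 := by omega
        simp [h4, h3.not_gt, h5]
    · have h1 : firstIdx p (k + 1) = firstIdx p k := by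
        ext a
        have := a.2
        simp only [firstIdx, Finset.mem_filter, Finset.mem_univ, true_and]
        omega
      rw [h1, ih]
      refine Finset.sum_congr rfl fun l _ => ?_
      have := l.2
      rw [if_pos (by omega), if_pos (by omega)]

variable {M : ℕ} {k : ℕ → ℕ}

/-- The shrinkage factor which the averaging weights `w` apply to the direction `l`. -/
def shrinkCoeff (k : ℕ → ℕ) (w : Fin M → ℝ) (l : ℕ) : ℝ :=
  ∑ m : Fin M, if l < k ((m : ℕ) + 1) then w m else 0

/-- The total weight of the candidates with index at least `m`. -/
def weightTail (w : Fin M → ℝ) (m : ℕ) : ℝ := ∑ j : Fin M, if m ≤ (j : ℕ) then w j else 0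

/-- The sum of `c` over the regressors which enter in the candidate `m`. -/
def blockSum (k : ℕ → ℕ) (c : Fin p → ℝ) (m : ℕ) : ℝ :=
  ∑ l ∈ Finset.univ.filter (fun l : Fin p => k m ≤ (l : ℕ) ∧ (l : ℕ) < k (m + 1)), c l

theorem IsNestedBasis.avgMatrix_eq (hφ : IsNestedBasis X φ) (w : Fin M → ℝ) :
    avgMatrix X (nestedModels p M k) w =
      ∑ l : Fin p, shrinkCoeff k w l • vecMulVec (φ l) (φ l) := by
  simp only [avgMatrix, nestedModels, hφ.projMatrix_firstIdx, Finset.smul_sum, shrinkCoeff,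
    Finset.sum_smul]
  rw [Finset.sum_comm]
  refine Finset.sum_congr rfl fun l _ => Finset.sum_congr rfl fun m _ => ?_
  split_ifs <;> simp

theorem IsNestedBasis.avgMatrix_mulVec (hφ : IsNestedBasis X φ) (w : Fin M → ℝ) (v : Fin n → ℝ) :
    avgMatrix X (nestedModels p M k) w *ᵥ v =
      ∑ l : Fin p, (shrinkCoeff k w l * (φ l ⬝ᵥ v)) • φ l := by
  rw [hφ.avgMatrix_eq, Matrix.sum_mulVec]
  refine Finset.sum_congr rfl fun l _ => ?_
  rw [Matrix.smul_mulVec, Matrix.vecMulVec_mulVec, mul_smul]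
  simp

theorem IsNestedBasis.sqNorm_sum (hX : LinearIndependent ℝ X.col) (hφ : IsNestedBasis X φ)
    (c : Fin p → ℝ) : sqNorm (∑ l, c l • φ l) = ∑ l, c l ^ 2 := by
  rw [sqNorm_eq_dotProduct, sum_dotProduct]
  refine Finset.sum_congr rfl fun l _ => ?_
  rw [dotProduct_sum]
  simp [hφ.dotProduct_eq hX, sq]

theorem IsNestedBasis.sqNorm_avgMatrix_mulVec_sub (hX : LinearIndependent ℝ X.col)
    (hφ : IsNestedBasis X φ) (w : Fin M → ℝ) (v u : Fin n → ℝ) :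
    sqNorm (avgMatrix X (nestedModels p M k) w *ᵥ v - u) = sqNorm u +
      ∑ l : Fin p, (shrinkCoeff k w l ^ 2 * (φ l ⬝ᵥ v) ^ 2 -
        2 * (shrinkCoeff k w l * ((φ l ⬝ᵥ v) * (φ l ⬝ᵥ u)))) := by
  rw [sqNorm_sub, hφ.avgMatrix_mulVec, hφ.sqNorm_sum hX, sum_dotProduct, Finset.sum_sub_distrib,
    ← Finset.mul_sum]
  simp only [smul_dotProduct, smul_eq_mul, mul_pow, mul_assoc]
  ring

theorem IsNestedBasis.trace_avgMatrix (hX : LinearIndependent ℝ X.col) (hφ : IsNestedBasis X φ)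
    (w : Fin M → ℝ) :
    ((avgMatrix X (nestedModels p M k) w)ᵀ * avgMatrix X (nestedModels p M k) w).trace =
      ∑ l : Fin p, shrinkCoeff k w l ^ 2 := by
  rw [hφ.avgMatrix_eq, Matrix.transpose_sum, Finset.sum_mul, Matrix.trace_sum]
  refine Finset.sum_congr rfl fun l _ => ?_
  rw [Finset.mul_sum, Matrix.trace_sum]
  simp only [Matrix.transpose_smul, Matrix.transpose_vecMulVec, Matrix.smul_mul, Matrix.mul_smul,
    Matrix.vecMulVec_mul_vecMulVec, hφ.dotProduct_eq hX, Matrix.trace_smul,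
    Matrix.trace_vecMulVec, dotProduct_smul, smul_eq_mul]
  simp [sq]

theorem sum_card_nestedModels (w : Fin M → ℝ) :
    ∑ m, ((nestedModels p M k m).card : ℝ) * w m = ∑ l : Fin p, shrinkCoeff k w l := by
  simp only [shrinkCoeff]
  rw [Finset.sum_comm]
  refine Finset.sum_congr rfl fun m _ => ?_
  rw [nestedModels, firstIdx, Finset.card_filter, Nat.cast_sum, Finset.sum_mul]
  refine Finset.sum_congr rfl fun l _ => ?_
  split_ifs <;> simp

theorem le_of_strict_steps (hk : ∀ m < M, k m < k (m + 1)) {i j : ℕ} (hij : i ≤ j)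
    (hj : j ≤ M) : k i ≤ k j := by
  induction j, hij using Nat.le_induction with
  | base => exact le_rfl
  | succ j _ ih => exact (ih (by omega)).trans (hk j (by omega)).le

theorem sum_Ico_blockSum (hk : ∀ m < M, k m < k (m + 1)) (c : Fin p → ℝ) {i j : ℕ} (hij : i ≤ j)
    (hj : j ≤ M) :
    ∑ m ∈ Finset.Ico i j, blockSum k c m =
      ∑ l ∈ Finset.univ.filter (fun l : Fin p => k i ≤ (l : ℕ) ∧ (l : ℕ) < k j), c l := by
  induction j, hij using Nat.le_induction with
  | base =>
    rw [Finset.Ico_self, Finset.sum_empty, Finset.sum_eq_zero]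
    intro l hl
    have := (Finset.mem_filter.1 hl).2
    omega
  | succ j hij ih =>
    have hmono : k i ≤ k j := le_of_strict_steps hk hij (by omega)
    rw [Finset.sum_Ico_succ_top hij, ih (by omega), blockSum, Finset.sum_filter,
      Finset.sum_filter, Finset.sum_filter, ← Finset.sum_add_distrib]
    refine Finset.sum_congr rfl fun l _ => ?_
    have hkj := hk j (by omega)
    by_cases h1 : (l : ℕ) < k j
    · by_cases h2 : k i ≤ (l : ℕ)
      · simp [h1, h2, h1.not_ge, h1.trans hkj]
      · simp [h2, h1.not_ge]
    · have h2 : k i ≤ (l : ℕ) := by omega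
      have h3 : k j ≤ (l : ℕ) := by omega
      simp [h1, h2, h3]

theorem shrinkCoeff_eq_weightTail (hk : ∀ m < M, k m < k (m + 1)) (w : Fin M → ℝ) {m l : ℕ}
    (hm : m < M) (h1 : k m ≤ l) (h2 : l < k (m + 1)) : shrinkCoeff k w l = weightTail w m := by
  refine Finset.sum_congr rfl fun j _ => ?_
  have hj := j.2
  rcases le_or_gt m (j : ℕ) with h | h
  · have := le_of_strict_steps hk (show m + 1 ≤ (j : ℕ) + 1 by omega) (by omega)
    rw [if_pos (by omega), if_pos h]
  · have := le_of_strict_steps hk (show (j : ℕ) + 1 ≤ m by omega) hm.le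
    rw [if_neg (by omega), if_neg (by omega)]

theorem shrinkCoeff_eq_zero (hk : ∀ m < M, k m < k (m + 1)) (w : Fin M → ℝ) {l : ℕ}
    (h : k M ≤ l) : shrinkCoeff k w l = 0 := by
  refine Finset.sum_eq_zero fun j _ => ?_
  have hj := j.2
  have := le_of_strict_steps hk (show (j : ℕ) + 1 ≤ M by omega) le_rfl
  rw [if_neg (by omega)]

/-- The shrinkage factor is constant on each block, so a sum over `p` directions collapses to `M`
blocks; directions beyond `k M` have factor zero and drop out because `h 0 = 0`. -/
theorem sum_shrinkCoeff (hk0 : k 0 = 0) (hk : ∀ m < M, k m < k (m + 1)) (w : Fin M → ℝ)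
    (h : ℝ → ℝ) (h0 : h 0 = 0) (c : Fin p → ℝ) :
    ∑ l : Fin p, h (shrinkCoeff k w l) * c l =
      ∑ m ∈ Finset.range M, h (weightTail w m) * blockSum k c m := by
  have h1 : ∑ m ∈ Finset.range M, h (weightTail w m) * blockSum k c m =
      ∑ m ∈ Finset.Ico 0 M, blockSum k (fun l => h (shrinkCoeff k w l) * c l) m := by
    rw [Finset.range_eq_Ico]
    refine Finset.sum_congr rfl fun m hm => ?_
    rw [blockSum, blockSum, Finset.mul_sum]
    refine Finset.sum_congr rfl fun l hl => ?_
    have hl' := (Finset.mem_filter.1 hl).2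
    rw [shrinkCoeff_eq_weightTail hk w (Finset.mem_Ico.1 hm).2 hl'.1 hl'.2]
  rw [h1, sum_Ico_blockSum hk _ (Nat.zero_le M) le_rfl]
  refine (Finset.sum_filter_of_ne fun l _ hne => ?_).symm
  refine ⟨by omega, ?_⟩
  by_contra hcon
  refine hne ?_
  rw [shrinkCoeff_eq_zero hk w (not_lt.1 hcon), h0, zero_mul]

theorem weightTail_zero {w : Fin M → ℝ} (hw : w ∈ stdSimplex ℝ (Fin M)) : weightTail w 0 = 1 := by
  simpa [weightTail] using hw.2

theorem weightTail_nonneg {w : Fin M → ℝ} (hw : w ∈ stdSimplex ℝ (Fin M)) (m : ℕ) :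
    0 ≤ weightTail w m :=
  Finset.sum_nonneg fun j _ => by
    split_ifs
    · exact hw.1 j
    · exact le_rfl

theorem weightTail_antitone {w : Fin M → ℝ} (hw : w ∈ stdSimplex ℝ (Fin M)) :
    Antitone (weightTail w) := fun i j hij =>
  Finset.sum_le_sum fun l _ => by
    have := hw.1 l
    split_ifs <;> first | omega | linarith

theorem weightTail_le_one {w : Fin M → ℝ} (hw : w ∈ stdSimplex ℝ (Fin M)) (m : ℕ) :
    weightTail w m ≤ 1 :=
  weightTail_zero hw ▸ weightTail_antitone hw (Nat.zero_le m)

theorem blockSum_add (c c' : Fin p → ℝ) (m : ℕ) :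
    blockSum k (fun l => c l + c' l) m = blockSum k c m + blockSum k c' m :=
  Finset.sum_add_distrib

theorem blockSum_const_mul (a : ℝ) (c : Fin p → ℝ) (m : ℕ) :
    blockSum k (fun l => a * c l) m = a * blockSum k c m :=
  (Finset.mul_sum _ _ _).symm

theorem card_filter_Ico {i j : ℕ} (hj : j ≤ p) :
    (Finset.univ.filter fun l : Fin p => i ≤ (l : ℕ) ∧ (l : ℕ) < j).card = j - i := by
  rw [← Nat.card_Ico, ← Finset.card_map Fin.valEmbedding]
  congr 1
  ext a
  simp only [Finset.mem_map, Finset.mem_filter, Finset.mem_univ, true_and, Fin.valEmbedding_apply,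
    Finset.mem_Ico]
  constructor
  · rintro ⟨l, h, rfl⟩
    exact h
  · exact fun h => ⟨⟨a, by omega⟩, h, rfl⟩

/-- `⟨e, D_m f⟩`, with `D_m` the projection onto the directions of block `m`. -/
def crossTerm (φ : Fin p → Fin n → ℝ) (k : ℕ → ℕ) (f e : Fin n → ℝ) (m : ℕ) : ℝ :=
  blockSum k (fun l => (φ l ⬝ᵥ f) * (φ l ⬝ᵥ e)) m

/-- `‖D_m e‖² - σ² tr D_m`. -/
def quadTerm (φ : Fin p → Fin n → ℝ) (k : ℕ → ℕ) (σ : ℝ) (e : Fin n → ℝ) (m : ℕ) : ℝ :=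
  blockSum k (fun l => (φ l ⬝ᵥ e) ^ 2 - σ ^ 2) m

/-- `‖D_m f‖²`. -/
def biasTerm (φ : Fin p → Fin n → ℝ) (k : ℕ → ℕ) (f : Fin n → ℝ) (m : ℕ) : ℝ :=
  blockSum k (fun l => (φ l ⬝ᵥ f) ^ 2) m

/-- `tr D_m`. -/
def dimTerm (p : ℕ) (k : ℕ → ℕ) (m : ℕ) : ℝ := blockSum (p := p) k (fun _ => 1) m

theorem biasTerm_nonneg (f : Fin n → ℝ) (m : ℕ) : 0 ≤ biasTerm φ k f m := by
  unfold biasTerm blockSum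
  exact Finset.sum_nonneg fun _ _ => sq_nonneg _

theorem dimTerm_nonneg (m : ℕ) : 0 ≤ dimTerm p k m := by
  unfold dimTerm blockSum
  exact Finset.sum_nonneg fun _ _ => zero_le_one

theorem blockSum_sq_dotProduct_add (σ : ℝ) (f e : Fin n → ℝ) (m : ℕ) :
    blockSum k (fun l => (φ l ⬝ᵥ (f + e)) ^ 2) m = biasTerm φ k f m + 2 * crossTerm φ k f e m +
      quadTerm φ k σ e m + σ ^ 2 * dimTerm p k m := by
  rw [biasTerm, crossTerm, quadTerm, dimTerm, ← blockSum_const_mul, ← blockSum_const_mul,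
    ← blockSum_add, ← blockSum_add, ← blockSum_add]
  congr 1
  ext l
  rw [dotProduct_add]
  ring

theorem blockSum_dotProduct_add_mul (f e : Fin n → ℝ) (m : ℕ) :
    blockSum k (fun l => (φ l ⬝ᵥ (f + e)) * (φ l ⬝ᵥ f)) m =
      biasTerm φ k f m + crossTerm φ k f e m := by
  rw [biasTerm, crossTerm, ← blockSum_add]
  congr 1
  ext l
  rw [dotProduct_add]
  ring

/-- Loss, plug-in risk and criterion are all expanded in the same block quantities, with the factor
`n` cleared, so that they can be compared coefficient by coefficient. -/
theorem mul_maLoss (hn : 0 < n) (hX : LinearIndependent ℝ X.col) (hφ : IsNestedBasis X φ)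
    (hk0 : k 0 = 0) (hk : ∀ m < M, k m < k (m + 1)) (σ : ℝ) (f e : Fin n → ℝ) (w : Fin M → ℝ) :
    n * maLoss X (nestedModels p M k) f w (f + e) = sqNorm f + ∑ m ∈ Finset.range M,
      (weightTail w m ^ 2 * (biasTerm φ k f m + 2 * crossTerm φ k f e m + quadTerm φ k σ e m +
        σ ^ 2 * dimTerm p k m) - 2 * (weightTail w m * (biasTerm φ k f m + crossTerm φ k f e m)))
      := by
  have hn' : (n : ℝ) ≠ 0 := by positivity
  rw [maLoss, maEstimator, hφ.sqNorm_avgMatrix_mulVec_sub hX, one_div, mul_inv_cancel_left₀ hn',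
    Finset.sum_sub_distrib, ← Finset.mul_sum,
    sum_shrinkCoeff hk0 hk w (fun t => t ^ 2) (by norm_num) fun l => (φ l ⬝ᵥ (f + e)) ^ 2,
    sum_shrinkCoeff hk0 hk w (fun t => t) rfl fun l => (φ l ⬝ᵥ (f + e)) * (φ l ⬝ᵥ f)]
  simp only [blockSum_sq_dotProduct_add σ, blockSum_dotProduct_add_mul]
  rw [Finset.sum_sub_distrib, Finset.mul_sum]

theorem mul_plugInRisk (hn : 0 < n) (hX : LinearIndependent ℝ X.col) (hφ : IsNestedBasis X φ)
    (hk0 : k 0 = 0) (hk : ∀ m < M, k m < k (m + 1)) (σ : ℝ) (f : Fin n → ℝ) (w : Fin M → ℝ) :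
    n * plugInRisk X (nestedModels p M k) f σ w = sqNorm f + ∑ m ∈ Finset.range M,
      ((weightTail w m ^ 2 - 2 * weightTail w m) * biasTerm φ k f m +
        σ ^ 2 * (weightTail w m ^ 2 * dimTerm p k m)) := by
  have hn' : (n : ℝ) ≠ 0 := by positivity
  have h1 : sqNorm (f - avgMatrix X (nestedModels p M k) w *ᵥ f) =
      sqNorm (avgMatrix X (nestedModels p M k) w *ᵥ f - f) := by
    rw [sqNorm_sub, sqNorm_sub, dotProduct_comm]
    ring
  have h2 : ∑ l : Fin p, shrinkCoeff k w l ^ 2 = ∑ l : Fin p, shrinkCoeff k w l ^ 2 * 1 := by simp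
  rw [plugInRisk, mul_add, h1, one_div, mul_inv_cancel_left₀ hn',
    hφ.sqNorm_avgMatrix_mulVec_sub hX, hφ.trace_avgMatrix hX, h2,
    sum_shrinkCoeff hk0 hk w (fun t => t ^ 2) (by norm_num) fun _ => 1,
    Finset.sum_add_distrib, ← Finset.mul_sum]
  simp only [biasTerm]
  rw [← sum_shrinkCoeff hk0 hk w (fun t => t ^ 2 - 2 * t) (by norm_num) fun l => (φ l ⬝ᵥ f) ^ 2]
  have h3 : ∀ l : Fin p, shrinkCoeff k w l ^ 2 * (φ l ⬝ᵥ f) ^ 2 -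
      2 * (shrinkCoeff k w l * ((φ l ⬝ᵥ f) * (φ l ⬝ᵥ f))) =
      (shrinkCoeff k w l ^ 2 - 2 * shrinkCoeff k w l) * (φ l ⬝ᵥ f) ^ 2 := fun l => by ring
  simp only [h3, dimTerm]
  field_simp
  ring

theorem mul_mmaCriterion (hn : 0 < n) (hX : LinearIndependent ℝ X.col) (hφ : IsNestedBasis X φ)
    (hk0 : k 0 = 0) (hk : ∀ m < M, k m < k (m + 1)) (σ s : ℝ) (f e : Fin n → ℝ) (w : Fin M → ℝ) :
    n * mmaCriterion X (nestedModels p M k) s (f + e) w = sqNorm (f + e) +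
      ∑ m ∈ Finset.range M, ((weightTail w m ^ 2 - 2 * weightTail w m) *
        (biasTerm φ k f m + 2 * crossTerm φ k f e m + quadTerm φ k σ e m + σ ^ 2 * dimTerm p k m) +
        2 * s * (weightTail w m * dimTerm p k m)) := by
  have hn' : (n : ℝ) ≠ 0 := by positivity
  have h1 : sqNorm (f + e - maEstimator X (nestedModels p M k) w (f + e)) =
      sqNorm (avgMatrix X (nestedModels p M k) w *ᵥ (f + e) - (f + e)) := by
    rw [maEstimator, sqNorm_sub, sqNorm_sub, dotProduct_comm]
    ring
  have h2 : ∑ l : Fin p, shrinkCoeff k w l = ∑ l : Fin p, shrinkCoeff k w l * 1 := by simp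
  rw [mmaCriterion, mul_add, h1, one_div, mul_inv_cancel_left₀ hn',
    hφ.sqNorm_avgMatrix_mulVec_sub hX, sum_card_nestedModels, h2,
    sum_shrinkCoeff hk0 hk w (fun t => t) rfl fun _ => 1,
    Finset.sum_add_distrib, ← Finset.mul_sum]
  simp only [← blockSum_sq_dotProduct_add σ]
  rw [← sum_shrinkCoeff hk0 hk w (fun t => t ^ 2 - 2 * t) (by norm_num)
    fun l => (φ l ⬝ᵥ (f + e)) ^ 2]
  have h3 : ∀ l : Fin p, shrinkCoeff k w l ^ 2 * (φ l ⬝ᵥ (f + e)) ^ 2 -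
      2 * (shrinkCoeff k w l * ((φ l ⬝ᵥ (f + e)) * (φ l ⬝ᵥ (f + e)))) =
      (shrinkCoeff k w l ^ 2 - 2 * shrinkCoeff k w l) * (φ l ⬝ᵥ (f + e)) ^ 2 := fun l => by ring
  simp only [h3, dimTerm]
  field_simp
  ring

/-- Bessel's inequality. -/
theorem sum_biasTerm_le (hX : LinearIndependent ℝ X.col) (hφ : IsNestedBasis X φ)
    (hk : ∀ m < M, k m < k (m + 1)) (f : Fin n → ℝ) :
    ∑ m ∈ Finset.range M, biasTerm φ k f m ≤ sqNorm f := by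
  have h1 : ∑ m ∈ Finset.range M, biasTerm φ k f m ≤ ∑ l, (φ l ⬝ᵥ f) ^ 2 := by
    rw [Finset.range_eq_Ico]
    simp only [biasTerm]
    rw [sum_Ico_blockSum hk _ (Nat.zero_le M) le_rfl]
    exact Finset.sum_le_sum_of_subset_of_nonneg (Finset.filter_subset _ _)
      fun l _ _ => sq_nonneg _
  have h2 : 0 ≤ sqNorm (∑ l, (φ l ⬝ᵥ f) • φ l - f) := Finset.sum_nonneg fun _ _ => sq_nonneg _
  rw [sqNorm_sub, hφ.sqNorm_sum hX, sum_dotProduct] at h2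
  simp only [smul_dotProduct, smul_eq_mul, ← sq] at h2
  linarith

theorem sum_Ico_dimTerm (hk : ∀ m < M, k m < k (m + 1)) (hkp : k M ≤ p) {i j : ℕ} (hij : i ≤ j)
    (hj : j ≤ M) : ∑ m ∈ Finset.Ico i j, dimTerm p k m = (k j : ℝ) - k i := by
  simp only [dimTerm]
  rw [sum_Ico_blockSum hk _ hij hj, Finset.sum_const,
    card_filter_Ico ((le_of_strict_steps hk hj le_rfl).trans hkp), nsmul_eq_mul, mul_one,
    Nat.cast_sub (le_of_strict_steps hk hij hj)]

end

/-! ### Uniform bounds for the noise on blocks -/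

section
variable {Ω : Type*} [MeasurableSpace Ω] {P : Measure Ω} [IsProbabilityMeasure P]
  {n p M : ℕ} {X : Matrix (Fin n) (Fin p) ℝ} {φ : Fin p → Fin n → ℝ} {ε : Fin n → Ω → ℝ}
  {k : ℕ → ℕ} {σ : ℝ}

theorem IsNestedBasis.sqNorm_sum_finset (hX : LinearIndependent ℝ X.col) (hφ : IsNestedBasis X φ)
    (c : Fin p → ℝ) (F : Finset (Fin p)) : sqNorm (∑ l ∈ F, c l • φ l) = ∑ l ∈ F, c l ^ 2 := by
  have h := hφ.sqNorm_sum hX fun l => if l ∈ F then c l else 0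
  simpa [ite_smul, ite_pow, Finset.sum_ite_mem] using h

omit [MeasurableSpace Ω] in
theorem sum_crossTerm_eq (f : Fin n → ℝ) (F : Finset (Fin p)) (ω : Ω) :
    ∑ l ∈ F, (φ l ⬝ᵥ f) * (φ l ⬝ᵥ fun i => ε i ω) =
      ∑ i ∈ Finset.univ, (∑ l ∈ F, (φ l ⬝ᵥ f) • φ l) i * ε i ω := by
  change _ = (∑ l ∈ F, (φ l ⬝ᵥ f) • φ l) ⬝ᵥ fun i => ε i ω
  rw [sum_dotProduct]
  simp

theorem integral_crossTerm (hX : LinearIndependent ℝ X.col) (hφ : IsNestedBasis X φ)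
    (hind : iIndepFun ε P) (h4 : ∀ i, MemLp (ε i) 4 P)
    (h0 : ∀ i, ∫ ω, ε i ω ∂P = 0) (h2 : ∀ i, ∫ ω, ε i ω ^ 2 ∂P = σ ^ 2) (f : Fin n → ℝ)
    (F : Finset (Fin p)) :
    ∫ ω, ∑ l ∈ F, (φ l ⬝ᵥ f) * (φ l ⬝ᵥ fun i => ε i ω) ∂P = 0 ∧
    ∫ ω, (∑ l ∈ F, (φ l ⬝ᵥ f) * (φ l ⬝ᵥ fun i => ε i ω)) ^ 2 ∂P =
      σ ^ 2 * ∑ l ∈ F, (φ l ⬝ᵥ f) ^ 2 := by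
  simp only [sum_crossTerm_eq]
  refine ⟨integral_linear h4 h0 _ _, ?_⟩
  rw [integral_sq_linear hind h4 h0 h2, ← hφ.sqNorm_sum_finset hX]
  rfl

/-- The matrix of the projection onto the span of `φ l`, `l ∈ F`. -/
def spanMatrix (φ : Fin p → Fin n → ℝ) (F : Finset (Fin p)) : Matrix (Fin n) (Fin n) ℝ :=
  Matrix.of fun a b => ∑ l ∈ F, φ l a * φ l b

omit [MeasurableSpace Ω] in
-- The squared norm of a projection of the errors is a quadratic form whose matrix has trace
-- `F.card`, which is exactly the centring.
theorem sum_quadTerm_eq (hφ : IsNestedBasis X φ) (F : Finset (Fin p)) (ω : Ω) :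
    ∑ l ∈ F, ((φ l ⬝ᵥ fun i => ε i ω) ^ 2 - σ ^ 2) =
      centredQuad (spanMatrix φ F) σ ε Finset.univ ω := by
  have h1 : ∑ a, spanMatrix φ F a a = F.card := by
    simp only [spanMatrix, Matrix.of_apply]
    rw [Finset.sum_comm, ← nsmul_one, ← Finset.sum_const]
    exact Finset.sum_congr rfl fun l _ => hφ.dotProduct_self l
  have h2 : ∑ a, ∑ b, spanMatrix φ F a b * (ε a ω * ε b ω) =
      ∑ l ∈ F, (φ l ⬝ᵥ fun i => ε i ω) ^ 2 := by
    simp only [spanMatrix, Matrix.of_apply, Finset.sum_mul]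
    have h3 : ∀ a, ∑ b, ∑ l ∈ F, φ l a * φ l b * (ε a ω * ε b ω) =
      ∑ l ∈ F, ∑ b, φ l a * φ l b * (ε a ω * ε b ω) := fun a => Finset.sum_comm
    simp only [h3]
    rw [Finset.sum_comm]
    refine Finset.sum_congr rfl fun l _ => ?_
    rw [sq, dotProduct, Finset.sum_mul_sum]
    exact Finset.sum_congr rfl fun a _ => Finset.sum_congr rfl fun b _ => by ring
  rw [centredQuad, h1, h2, Finset.sum_sub_distrib, Finset.sum_const, nsmul_eq_mul]
  ring

/-- The squared Frobenius norm of an orthogonal projection is its rank; this makes the variance of a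
block proportional to its dimension. -/
theorem sum_sq_spanMatrix (hX : LinearIndependent ℝ X.col) (hφ : IsNestedBasis X φ)
    (F : Finset (Fin p)) : ∑ a, ∑ b, spanMatrix φ F a b ^ 2 = F.card := by
  have h1 : ∀ a b, spanMatrix φ F a b = (∑ l ∈ F, φ l a • φ l) b := by
    intro a b
    simp [spanMatrix]
  have h2 : ∀ a, ∑ b, spanMatrix φ F a b ^ 2 = ∑ l ∈ F, φ l a ^ 2 := by
    intro a
    rw [← hφ.sqNorm_sum_finset hX]
    simp only [h1]
    rfl
  simp only [h2]
  rw [Finset.sum_comm, ← nsmul_one, ← Finset.sum_const]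
  exact Finset.sum_congr rfl fun l _ => (hφ l).1

theorem integral_quadTerm (hX : LinearIndependent ℝ X.col) (hφ : IsNestedBasis X φ)
    (hind : iIndepFun ε P) (h4 : ∀ i, MemLp (ε i) 4 P)
    (h0 : ∀ i, ∫ ω, ε i ω ∂P = 0) (h2 : ∀ i, ∫ ω, ε i ω ^ 2 ∂P = σ ^ 2)
    {m : ℝ} (hm4 : ∀ i, ∫ ω, ε i ω ^ 4 ∂P ≤ m) (F : Finset (Fin p)) :
    ∫ ω, ∑ l ∈ F, ((φ l ⬝ᵥ fun i => ε i ω) ^ 2 - σ ^ 2) ∂P = 0 ∧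
    ∫ ω, (∑ l ∈ F, ((φ l ⬝ᵥ fun i => ε i ω) ^ 2 - σ ^ 2)) ^ 2 ∂P ≤
      (2 * m + 8 * σ ^ 4) * F.card := by
  have hA : (spanMatrix φ F)ᵀ = spanMatrix φ F := by
    ext a b
    simp [spanMatrix, mul_comm]
  have h := integral_centredQuad hind h4 h0 h2 hA hm4 Finset.univ
  rw [sum_sq_spanMatrix hX hφ] at h
  simpa only [sum_quadTerm_eq hφ] using h

theorem memLp_crossTerm (h4 : ∀ i, MemLp (ε i) 4 P) (f : Fin n → ℝ) (m : ℕ) :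
    MemLp (fun ω => crossTerm φ k f (fun i => ε i ω) m) 2 P := by
  simp only [crossTerm, blockSum, sum_crossTerm_eq]
  exact memLp_finsetSum _ fun i _ => ((h4 i).mono_exponent (by norm_num)).const_mul _

theorem memLp_quadTerm (hφ : IsNestedBasis X φ) (h4 : ∀ i, MemLp (ε i) 4 P) (m : ℕ) :
    MemLp (fun ω => quadTerm φ k σ (fun i => ε i ω) m) 2 P := by
  simp only [quadTerm, blockSum, sum_quadTerm_eq hφ]
  exact memLp_centredQuad h4 _ _ _

theorem tailS_transCoeff (hn : 0 < n) (hk : ∀ m < M, k m < k (m + 1)) (f : Fin n → ℝ) {j : ℕ}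
    (hj : j ≤ M) :
    n * tailS (transCoeff φ f) k M j = ∑ m ∈ Finset.Ico j M, biasTerm φ k f m := by
  have hn' : (0 : ℝ) < n := by exact_mod_cast hn
  simp only [biasTerm]
  rw [sum_Ico_blockSum hk _ hj le_rfl, tailS, Finset.mul_sum]
  refine Finset.sum_congr rfl fun l _ => ?_
  rw [transCoeff, div_pow, Real.sq_sqrt hn'.le]
  field_simp

theorem tailS_nonneg (θ : Fin p → ℝ) (M j : ℕ) : 0 ≤ tailS θ k M j :=
  Finset.sum_nonneg fun _ _ => sq_nonneg _

theorem tailS_anti (hk : ∀ m < M, k m < k (m + 1)) (θ : Fin p → ℝ) {i j : ℕ} (hij : i ≤ j)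
    (hj : j ≤ M) : tailS θ k M j ≤ tailS θ k M i := by
  refine Finset.sum_le_sum_of_subset_of_nonneg (fun l hl => ?_) fun _ _ _ => sq_nonneg _
  have := le_of_strict_steps hk hij hj
  simp only [Finset.mem_filter, Finset.mem_univ, true_and] at hl ⊢
  omega

/-- The infimum is over a nonempty set, since `M` belongs to it: its tail is an empty sum. -/
theorem firstZero_spec (hM : 1 ≤ M) (θ : Fin p → ℝ) :
    1 ≤ firstZero θ k M ∧ firstZero θ k M ≤ M ∧ tailS θ k M (firstZero θ k M) = 0 := by
  refine Nat.sInf_mem (s := {j : ℕ | 1 ≤ j ∧ j ≤ M ∧ tailS θ k M j = 0}) ⟨M, hM, le_rfl, ?_⟩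
  refine Finset.sum_eq_zero fun l hl => ?_
  have := (Finset.mem_filter.1 hl).2
  omega

theorem sum_dim_ratio_nonneg (hk : ∀ m < M, k m < k (m + 1)) :
    0 ≤ ∑ j ∈ Finset.Icc 1 (M - 1), ((k (j + 1) : ℝ) - (k j : ℝ)) / (4 * (k j : ℝ)) := by
  refine Finset.sum_nonneg fun j hj => ?_
  have hj' := Finset.mem_Icc.1 hj
  have : (k j : ℝ) ≤ k (j + 1) := by exact_mod_cast (hk j (by omega)).le
  have h2 : (0 : ℝ) ≤ k j := Nat.cast_nonneg _
  exact div_nonneg (by linarith) (by linarith)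

theorem sum_tailS_ratio_nonneg (hM : 1 ≤ M) (hk : ∀ m < M, k m < k (m + 1)) (θ : Fin p → ℝ) :
    0 ≤ ∑ j ∈ Finset.Icc 1 (firstZero θ k M - 1),
      (tailS θ k M (j - 1) - tailS θ k M j) / (4 * tailS θ k M j) := by
  refine Finset.sum_nonneg fun j hj => ?_
  have hj' := Finset.mem_Icc.1 hj
  have h1 := (firstZero_spec (k := k) hM θ).2.1
  have h2 := tailS_anti hk θ (Nat.sub_le j 1) (show j ≤ M by omega)
  have h3 := tailS_nonneg (k := k) θ M j
  exact div_nonneg (by linarith) (by linarith)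

theorem psi_nonneg (hM : 1 ≤ M) (hk : ∀ m < M, k m < k (m + 1)) (θ : Fin p → ℝ) :
    0 ≤ psi θ k M := by
  have h1 := sum_dim_ratio_nonneg hk
  have h2 := sum_tailS_ratio_nonneg hM hk θ
  exact mul_nonneg (le_min (Nat.cast_nonneg _) (by linarith)) (sq_nonneg _)

/-- The maximal inequality with `a` the block biases, whose tail sums are `n` times those in `ψ`.
The factor `n` cancels in the ratios, and the dimension ratios of `ψ` are added for free. -/
theorem exists_crossTerm_bound (hn : 0 < n) (hX : LinearIndependent ℝ X.col)
    (hφ : IsNestedBasis X φ) (hind : iIndepFun ε P) (h4 : ∀ i, MemLp (ε i) 4 P)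
    (h0 : ∀ i, ∫ ω, ε i ω ∂P = 0) (h2 : ∀ i, ∫ ω, ε i ω ^ 2 ∂P = σ ^ 2)
    (hM : 1 ≤ M) (hk : ∀ m < M, k m < k (m + 1)) (f : Fin n → ℝ) :
    ∃ Z : Ω → ℝ, Integrable Z P ∧ (∀ ω, 0 ≤ Z ω) ∧
      ∫ ω, Z ω ∂P ≤ 192 * σ ^ 2 * psi (transCoeff φ f) k M ∧
      ∀ᵐ ω ∂P, ∀ x : ℕ → ℝ, Monotone x → 0 ≤ x 0 →
        (∑ m ∈ Finset.range M, x m * crossTerm φ k f (fun i => ε i ω) m) ^ 2 ≤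
          Z ω * ∑ m ∈ Finset.range M, x m ^ 2 * biasTerm φ k f m := by
  have hn' : (0 : ℝ) < n := by exact_mod_cast hn
  set θ := transCoeff φ f with hθ
  obtain ⟨hf1, hf2, hf3⟩ := firstZero_spec (k := k) hM θ
  obtain ⟨Z, hZ1, hZ2, hZ3, hZ4⟩ := exists_monotone_bound (P := P) hM
    (fun m ω => crossTerm φ k f (fun i => ε i ω) m) (biasTerm φ k f) (biasTerm_nonneg f)
    (K := σ ^ 2) (sq_nonneg σ) (memLp_crossTerm h4 f)
    (fun i j hij hj => by
      simp only [crossTerm, biasTerm, sum_Ico_blockSum hk _ hij hj]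
      exact (integral_crossTerm hX hφ hind h4 h0 h2 f _).2.le)
    (fun j => n * tailS θ k M j) (fun j hj => tailS_transCoeff hn hk f hj)
    (N := firstZero θ k M - 1)
    -- Tails vanish from `firstZero` on, so positive ones stop one index earlier.
    (fun j hj hp => by
      by_contra hcon
      have h5 := tailS_anti hk θ (show firstZero θ k M ≤ j by omega) hj.le
      have h6 : tailS θ k M j = 0 := le_antisymm (hf3 ▸ h5) (tailS_nonneg _ _ _)
      simp [h6] at hp) (by omega)
  refine ⟨Z, hZ1, hZ2, hZ3.trans ?_, hZ4⟩
  refine mul_le_mul_of_nonneg_left ?_ (by positivity)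
  refine mul_le_mul_of_nonneg_right ?_ (sq_nonneg _)
  refine min_le_min le_rfl ?_
  have h5 : ∀ j, (n * tailS θ k M (j - 1) - n * tailS θ k M j) / (4 * (n * tailS θ k M j)) =
      (tailS θ k M (j - 1) - tailS θ k M j) / (4 * tailS θ k M j) := by
    intro j
    rw [← mul_sub, mul_left_comm, mul_div_mul_left _ _ hn'.ne']
  simp only [h5]
  linarith [sum_dim_ratio_nonneg hk]

/-- Reversing the order of the blocks makes the antitone multipliers monotone. The reversed tail
sums of the dimensions are the model sizes `k (M - j)`, whose ratios are the dimension sum in `ψ`.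
-/
theorem exists_quadTerm_bound (hX : LinearIndependent ℝ X.col)
    (hφ : IsNestedBasis X φ) (hind : iIndepFun ε P) (h4 : ∀ i, MemLp (ε i) 4 P)
    (h0 : ∀ i, ∫ ω, ε i ω ∂P = 0) (h2 : ∀ i, ∫ ω, ε i ω ^ 2 ∂P = σ ^ 2)
    {c : ℝ} (hc : 0 ≤ c) (hm4 : ∀ i, ∫ ω, ε i ω ^ 4 ∂P ≤ c)
    (hM : 1 ≤ M) (hk0 : k 0 = 0) (hk : ∀ m < M, k m < k (m + 1)) (hkp : k M ≤ p)
    (θ : Fin p → ℝ) :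
    ∃ Z : Ω → ℝ, Integrable Z P ∧ (∀ ω, 0 ≤ Z ω) ∧
      ∫ ω, Z ω ∂P ≤ 192 * (2 * c + 8 * σ ^ 4) * psi θ k M ∧
      ∀ᵐ ω ∂P, ∀ x : ℕ → ℝ, Antitone x → (∀ m, 0 ≤ x m) →
        (∑ m ∈ Finset.range M, x m * quadTerm φ k σ (fun i => ε i ω) m) ^ 2 ≤
          Z ω * ∑ m ∈ Finset.range M, x m ^ 2 * dimTerm p k m := by
  have hK : 0 ≤ 2 * c + 8 * σ ^ 4 := by positivity
  have hrefl : ∀ (g : ℕ → ℝ) (i j : ℕ), j ≤ M →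
      ∑ m ∈ Finset.Ico i j, g (M - 1 - m) = ∑ m ∈ Finset.Ico (M - j) (M - i), g m := by
    intro g i j hj
    have := Finset.sum_Ico_reflect g i (show j ≤ M - 1 + 1 by omega)
    rwa [Nat.sub_add_cancel hM] at this
  obtain ⟨Z, hZ1, hZ2, hZ3, hZ4⟩ := exists_monotone_bound (P := P) hM
    (fun m ω => quadTerm φ k σ (fun i => ε i ω) (M - 1 - m)) (fun m => dimTerm p k (M - 1 - m))
    (fun m => dimTerm_nonneg _)
    (K := 2 * c + 8 * σ ^ 4) hK (fun m => memLp_quadTerm hφ h4 _)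
    (fun i j hij hj => by
      simp only [hrefl (fun m => dimTerm p k m) i j hj,
        fun ω => hrefl (fun m => quadTerm φ k σ (fun i => ε i ω) m) i j hj]
      simp only [quadTerm, dimTerm, sum_Ico_blockSum hk _ (Nat.sub_le_sub_left hij M)
        (Nat.sub_le M i)]
      simpa using (integral_quadTerm hX hφ hind h4 h0 h2 hm4 _).2)
    (fun j => (k (M - j) : ℝ))
    (fun j hj => by
      rw [hrefl (fun m => dimTerm p k m) j M le_rfl,
        sum_Ico_dimTerm hk hkp (by omega) (Nat.sub_le M j), Nat.sub_self, hk0]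
      simp)
    (N := M - 1) (fun j hj _ => by omega) (Nat.sub_le _ _)
  refine ⟨Z, hZ1, hZ2, hZ3.trans ?_, ?_⟩
  · refine mul_le_mul_of_nonneg_left ?_ (by positivity)
    refine mul_le_mul_of_nonneg_right ?_ (sq_nonneg _)
    refine min_le_min le_rfl ?_
    have h5 : ∑ j ∈ Finset.Icc 1 (M - 1), ((k (M - (j - 1)) : ℝ) - k (M - j)) / (4 * k (M - j)) =
        ∑ j ∈ Finset.Icc 1 (M - 1), ((k (j + 1) : ℝ) - k j) / (4 * k j) := by
      refine Finset.sum_nbij' (fun j => M - j) (fun j => M - j) ?_ ?_ ?_ ?_ ?_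
      · intro j hj
        simp only [Finset.mem_Icc] at hj ⊢
        omega
      · intro j hj
        simp only [Finset.mem_Icc] at hj ⊢
        omega
      · intro j hj
        simp only [Finset.mem_Icc] at hj
        omega
      · intro j hj
        simp only [Finset.mem_Icc] at hj
        omega
      · intro j hj
        simp only [Finset.mem_Icc] at hj
        rw [show M - (j - 1) = M - j + 1 by omega]
    rw [h5]
    linarith [sum_tailS_ratio_nonneg hM hk θ]
  · filter_upwards [hZ4] with ω hω x hx hx0
    have := hω (fun m => x (M - 1 - m)) (fun i j hij => hx (Nat.sub_le_sub_left hij _)) (hx0 _)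
    rwa [Finset.sum_range_reflect
        (fun m => x m * quadTerm φ k σ (fun i => ε i ω) m) M,
      Finset.sum_range_reflect (fun m => x m ^ 2 * dimTerm p k m) M] at this

end

/-! ### Pathwise comparison of loss, risk and criterion -/

section
variable {n p M : ℕ} {X : Matrix (Fin n) (Fin p) ℝ} {φ : Fin p → Fin n → ℝ} {k : ℕ → ℕ} {σ : ℝ}

theorem abs_le_sqrt_mul_sqrt {a b c d : ℝ} (h : a ^ 2 ≤ b * c) (hb : 0 ≤ b) (hc : c ≤ d) :
    |a| ≤ Real.sqrt b * Real.sqrt d := by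
  rw [← Real.sqrt_mul hb]
  exact Real.abs_le_sqrt (h.trans (mul_le_mul_of_nonneg_left hc hb))

/-- Completing the square leaves the part of `sqNorm f` outside the blocks, nonnegative by Bessel.
Both denominators of the maximal inequalities are thus dominated by the risk. -/
theorem mul_plugInRisk_ge (hn : 0 < n) (hX : LinearIndependent ℝ X.col) (hφ : IsNestedBasis X φ)
    (hk0 : k 0 = 0) (hk : ∀ m < M, k m < k (m + 1)) (σ : ℝ) (f : Fin n → ℝ) (w : Fin M → ℝ) :
    ∑ m ∈ Finset.range M, (1 - weightTail w m) ^ 2 * biasTerm φ k f m +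
      σ ^ 2 * ∑ m ∈ Finset.range M, weightTail w m ^ 2 * dimTerm p k m ≤
    n * plugInRisk X (nestedModels p M k) f σ w := by
  rw [mul_plugInRisk hn hX hφ hk0 hk]
  have h := sum_biasTerm_le hX hφ hk f
  have h2 : ∑ m ∈ Finset.range M, (1 - weightTail w m) ^ 2 * biasTerm φ k f m =
      ∑ m ∈ Finset.range M, biasTerm φ k f m +
        ∑ m ∈ Finset.range M, (weightTail w m ^ 2 - 2 * weightTail w m) * biasTerm φ k f m := by
    rw [← Finset.sum_add_distrib]
    exact Finset.sum_congr rfl fun m _ => by ring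
  rw [h2, Finset.sum_add_distrib, ← Finset.mul_sum]
  linarith

section
variable (hn : 0 < n) (hX : LinearIndependent ℝ X.col) (hφ : IsNestedBasis X φ) (hk0 : k 0 = 0)
  (hk : ∀ m < M, k m < k (m + 1))
include hn hX hφ hk0 hk

/-- The natural multiplier `g * (1 - g)` of the cross terms is not monotone; it is written as `(1 -
g) - (1 - g)²`, a difference of two monotone ones. -/
theorem mul_maLoss_eq_risk_add (f e : Fin n → ℝ) (w : Fin M → ℝ) :
    n * maLoss X (nestedModels p M k) f w (f + e) =
      n * plugInRisk X (nestedModels p M k) f σ w -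
        2 * (∑ m ∈ Finset.range M, (1 - weightTail w m) * crossTerm φ k f e m -
          ∑ m ∈ Finset.range M, (1 - weightTail w m) ^ 2 * crossTerm φ k f e m) +
        ∑ m ∈ Finset.range M, weightTail w m ^ 2 * quadTerm φ k σ e m := by
  rw [mul_maLoss hn hX hφ hk0 hk σ, mul_plugInRisk hn hX hφ hk0 hk, ← Finset.sum_sub_distrib,
    Finset.mul_sum, add_sub_assoc, add_assoc, ← Finset.sum_sub_distrib, ← Finset.sum_add_distrib]
  congr 1
  exact Finset.sum_congr rfl fun m _ => by ring

/-- Loss minus criterion is affine in the tail weights, so minimality leaves only linear noise terms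
and the error of the variance estimator times a difference of model dimensions. The cross term
against `g` is rewritten with `1 - g` to obtain a nondecreasing multiplier. -/
theorem mul_maLoss_le_of_isMinOn {s : ℝ} {f e : Fin n → ℝ} {w v : Fin M → ℝ}
    (hv : v ∈ stdSimplex ℝ (Fin M))
    (hmin : IsMinOn (mmaCriterion X (nestedModels p M k) s (f + e)) (stdSimplex ℝ (Fin M)) w) :
    n * maLoss X (nestedModels p M k) f w (f + e) ≤
      n * maLoss X (nestedModels p M k) f v (f + e) +
        2 * (∑ m ∈ Finset.range M, crossTerm φ k f e m -
          ∑ m ∈ Finset.range M, weightTail v m * (crossTerm φ k f e m + quadTerm φ k σ e m)) -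
        2 * ∑ m ∈ Finset.range M, (1 - weightTail w m) * crossTerm φ k f e m +
        2 * ∑ m ∈ Finset.range M, weightTail w m * quadTerm φ k σ e m +
        2 * (σ ^ 2 - s) * (∑ m ∈ Finset.range M, weightTail w m * dimTerm p k m -
          ∑ m ∈ Finset.range M, weightTail v m * dimTerm p k m) := by
  have key : ∀ u : Fin M → ℝ, n * maLoss X (nestedModels p M k) f u (f + e) =
      n * mmaCriterion X (nestedModels p M k) s (f + e) u + sqNorm f - sqNorm (f + e) +
        2 * ∑ m ∈ Finset.range M, weightTail u m * (crossTerm φ k f e m + quadTerm φ k σ e m) +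
        2 * (σ ^ 2 - s) * ∑ m ∈ Finset.range M, weightTail u m * dimTerm p k m := by
    intro u
    rw [mul_maLoss hn hX hφ hk0 hk σ, mul_mmaCriterion hn hX hφ hk0 hk σ, Finset.mul_sum,
      Finset.mul_sum]
    have h2 : ∑ m ∈ Finset.range M,
        (weightTail u m ^ 2 * (biasTerm φ k f m + 2 * crossTerm φ k f e m + quadTerm φ k σ e m +
          σ ^ 2 * dimTerm p k m) -
          2 * (weightTail u m * (biasTerm φ k f m + crossTerm φ k f e m))) =
        ∑ m ∈ Finset.range M, ((weightTail u m ^ 2 - 2 * weightTail u m) *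
          (biasTerm φ k f m + 2 * crossTerm φ k f e m + quadTerm φ k σ e m +
            σ ^ 2 * dimTerm p k m) + 2 * s * (weightTail u m * dimTerm p k m)) +
        ∑ m ∈ Finset.range M,
          2 * (weightTail u m * (crossTerm φ k f e m + quadTerm φ k σ e m)) +
        ∑ m ∈ Finset.range M, 2 * (σ ^ 2 - s) * (weightTail u m * dimTerm p k m) := by
      rw [← Finset.sum_add_distrib, ← Finset.sum_add_distrib]
      exact Finset.sum_congr rfl fun m _ => by ring
    rw [h2]
    ring
  have hle : mmaCriterion X (nestedModels p M k) s (f + e) w ≤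
      mmaCriterion X (nestedModels p M k) s (f + e) v := hmin hv
  have hle' := mul_le_mul_of_nonneg_left hle (Nat.cast_nonneg (α := ℝ) n)
  rw [key w, key v]
  have h3 : ∑ m ∈ Finset.range M, weightTail w m * (crossTerm φ k f e m + quadTerm φ k σ e m) =
      ∑ m ∈ Finset.range M, crossTerm φ k f e m -
        ∑ m ∈ Finset.range M, (1 - weightTail w m) * crossTerm φ k f e m +
        ∑ m ∈ Finset.range M, weightTail w m * quadTerm φ k σ e m := by
    rw [← Finset.sum_sub_distrib, ← Finset.sum_add_distrib]
    exact Finset.sum_congr rfl fun m _ => by ring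
  rw [h3]
  linarith

theorem plugInRisk_nonneg (σ : ℝ) (f : Fin n → ℝ) (w : Fin M → ℝ) :
    0 ≤ n * plugInRisk X (nestedModels p M k) f σ w := by
  refine le_trans (add_nonneg ?_ (mul_nonneg (sq_nonneg σ) ?_))
    (mul_plugInRisk_ge hn hX hφ hk0 hk σ f w)
  · exact Finset.sum_nonneg fun m _ => mul_nonneg (sq_nonneg _) (biasTerm_nonneg f m)
  · exact Finset.sum_nonneg fun m _ => mul_nonneg (sq_nonneg _) (dimTerm_nonneg m)

/-- Cauchy–Schwarz against the total dimension `k M`. Multiplied by the error of the variance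
estimator, it produces `ρ`. -/
theorem sum_weightTail_mul_dimTerm_le (hσ : 0 < σ) (hkp : k M ≤ p) (f : Fin n → ℝ)
    (w : Fin M → ℝ) :
    |∑ m ∈ Finset.range M, weightTail w m * dimTerm p k m| ≤ Real.sqrt (k M / σ ^ 2) *
      Real.sqrt (n * plugInRisk X (nestedModels p M k) f σ w) := by
  have h1 := mul_plugInRisk_ge hn hX hφ hk0 hk σ f w
  have h2 : 0 ≤ ∑ m ∈ Finset.range M, (1 - weightTail w m) ^ 2 * biasTerm φ k f m :=
    Finset.sum_nonneg fun m _ => mul_nonneg (sq_nonneg _) (biasTerm_nonneg f m)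
  have h3 : (∑ m ∈ Finset.range M, weightTail w m * dimTerm p k m) ^ 2 ≤
      (∑ m ∈ Finset.range M, dimTerm p k m) *
        ∑ m ∈ Finset.range M, weightTail w m ^ 2 * dimTerm p k m :=
    Finset.sum_sq_le_sum_mul_sum_of_sq_le_mul _ (fun m _ => dimTerm_nonneg m)
      (fun m _ => mul_nonneg (sq_nonneg _) (dimTerm_nonneg m)) fun m _ => le_of_eq (by ring)
  have h4 : ∑ m ∈ Finset.range M, dimTerm p k m = k M := by
    rw [Finset.range_eq_Ico, sum_Ico_dimTerm hk hkp (Nat.zero_le M) le_rfl, hk0]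
    simp
  rw [h4] at h3
  refine abs_le_sqrt_mul_sqrt
    (c := σ ^ 2 * ∑ m ∈ Finset.range M, weightTail w m ^ 2 * dimTerm p k m) ?_ (by positivity)
    (by linarith)
  refine h3.trans (le_of_eq ?_)
  field_simp

/-- The noise terms of the loss, bounded in terms of the risk. -/
theorem noise_le (hσ : 0 < σ) {f e : Fin n → ℝ} {w : Fin M → ℝ}
    (hw : w ∈ stdSimplex ℝ (Fin M)) {z₁ z₂ : ℝ} (hz₁ : 0 ≤ z₁) (hz₂ : 0 ≤ z₂)
    (h₁ : ∀ x : ℕ → ℝ, Monotone x → 0 ≤ x 0 →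
        (∑ m ∈ Finset.range M, x m * crossTerm φ k f e m) ^ 2 ≤
          z₁ * ∑ m ∈ Finset.range M, x m ^ 2 * biasTerm φ k f m)
    (h₂ : ∀ x : ℕ → ℝ, Antitone x → (∀ m, 0 ≤ x m) →
        (∑ m ∈ Finset.range M, x m * quadTerm φ k σ e m) ^ 2 ≤
          z₂ * ∑ m ∈ Finset.range M, x m ^ 2 * dimTerm p k m) :
    |∑ m ∈ Finset.range M, (1 - weightTail w m) * crossTerm φ k f e m| ≤
        Real.sqrt z₁ * Real.sqrt (n * plugInRisk X (nestedModels p M k) f σ w) ∧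
    |∑ m ∈ Finset.range M, (1 - weightTail w m) ^ 2 * crossTerm φ k f e m| ≤
        Real.sqrt z₁ * Real.sqrt (n * plugInRisk X (nestedModels p M k) f σ w) ∧
    |∑ m ∈ Finset.range M, weightTail w m * quadTerm φ k σ e m| ≤
        Real.sqrt (z₂ / σ ^ 2) * Real.sqrt (n * plugInRisk X (nestedModels p M k) f σ w) ∧
    |∑ m ∈ Finset.range M, weightTail w m ^ 2 * quadTerm φ k σ e m| ≤
        Real.sqrt (z₂ / σ ^ 2) * Real.sqrt (n * plugInRisk X (nestedModels p M k) f σ w) := by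
  have hr := mul_plugInRisk_ge hn hX hφ hk0 hk σ f w
  have hb : 0 ≤ ∑ m ∈ Finset.range M, (1 - weightTail w m) ^ 2 * biasTerm φ k f m :=
    Finset.sum_nonneg fun m _ => mul_nonneg (sq_nonneg _) (biasTerm_nonneg f m)
  have hd : 0 ≤ σ ^ 2 * ∑ m ∈ Finset.range M, weightTail w m ^ 2 * dimTerm p k m :=
    mul_nonneg (sq_nonneg σ)
      (Finset.sum_nonneg fun m _ => mul_nonneg (sq_nonneg _) (dimTerm_nonneg m))
  have hb' := (le_add_of_nonneg_right hd).trans hr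
  have hd' := (le_add_of_nonneg_left hb).trans hr
  have hg0 := weightTail_nonneg hw
  have hg1 := weightTail_le_one hw
  have hga := weightTail_antitone hw
  have hmono : Monotone fun m => 1 - weightTail w m := fun i j hij => by
    have := hga hij
    dsimp only
    linarith
  have hx0 : ∀ m, 0 ≤ 1 - weightTail w m := fun m => by linarith [hg1 m]
  have hscale : ∀ t : ℝ, z₂ / σ ^ 2 * (σ ^ 2 * t) = z₂ * t := fun t => by field_simp
  -- Squared multipliers in `[0, 1]` have no larger denominator, so they obey the same bounds as the
  -- multipliers themselves.
  have hsq : ∀ t : ℝ, 0 ≤ t → t ≤ 1 → (t ^ 2) ^ 2 ≤ t ^ 2 := fun t ht0 ht1 => by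
    have h1 : t ^ 2 ≤ 1 := pow_le_one₀ ht0 ht1
    nlinarith [sq_nonneg t]
  refine ⟨?_, ?_, ?_, ?_⟩
  · exact abs_le_sqrt_mul_sqrt (h₁ _ hmono (hx0 0)) hz₁ (by linarith)
  · refine abs_le_sqrt_mul_sqrt (h₁ (fun m => (1 - weightTail w m) ^ 2)
      (fun i j hij => pow_le_pow_left₀ (hx0 i) (hmono hij) 2) (sq_nonneg _)) hz₁ ?_
    refine le_trans (Finset.sum_le_sum fun m _ => ?_) hb'
    exact mul_le_mul_of_nonneg_right (hsq _ (hx0 m) (by linarith [hg0 m])) (biasTerm_nonneg f m)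
  · refine abs_le_sqrt_mul_sqrt ?_ (by positivity) hd'
    rw [hscale]
    exact h₂ _ hga hg0
  · refine abs_le_sqrt_mul_sqrt
      (c := σ ^ 2 * ∑ m ∈ Finset.range M, (weightTail w m ^ 2) ^ 2 * dimTerm p k m) ?_
      (by positivity) ?_
    · rw [hscale]
      exact h₂ (fun m => weightTail w m ^ 2)
        (fun i j hij => pow_le_pow_left₀ (hg0 j) (hga hij) 2) fun m => sq_nonneg _
    · refine le_trans (mul_le_mul_of_nonneg_left (Finset.sum_le_sum fun m _ => ?_) (sq_nonneg σ))
        hd'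
      exact mul_le_mul_of_nonneg_right (hsq _ (hg0 m) (hg1 m)) (dimTerm_nonneg m)

end
end

/-! ### Cauchy–Schwarz in expectation and the self-bounding inequality -/

section
variable {Ω : Type*} [MeasurableSpace Ω] {P : Measure Ω}

theorem memLp_sqrt {Z : Ω → ℝ} (hZ : Integrable Z P) (hZ0 : 0 ≤ᵐ[P] Z) :
    MemLp (fun ω => Real.sqrt (Z ω)) 2 P := by
  refine (memLp_two_iff_integrable_sq
    (Real.continuous_sqrt.comp_aestronglyMeasurable hZ.1)).2 (hZ.congr ?_)
  filter_upwards [hZ0] with ω hω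
  exact (Real.sq_sqrt hω).symm

/-- The Cauchy–Schwarz inequality for the square roots of nonnegative integrable functions. -/
theorem integral_sqrt_mul_sqrt_le {Z R : Ω → ℝ} (hZ : Integrable Z P) (hR : Integrable R P)
    (hZ0 : 0 ≤ᵐ[P] Z) (hR0 : 0 ≤ᵐ[P] R) :
    Integrable (fun ω => Real.sqrt (Z ω) * Real.sqrt (R ω)) P ∧
    ∫ ω, Real.sqrt (Z ω) * Real.sqrt (R ω) ∂P ≤
      Real.sqrt (∫ ω, Z ω ∂P) * Real.sqrt (∫ ω, R ω ∂P) := by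
  have hI : Integrable (fun ω => Real.sqrt (Z ω) * Real.sqrt (R ω)) P :=
    (memLp_sqrt hZ hZ0).integrable_mul (memLp_sqrt hR hR0)
  refine ⟨hI, ?_⟩
  rw [← Real.sqrt_mul (integral_nonneg_of_ae hZ0)]
  refine (le_abs_self _).trans (Real.abs_le_sqrt ?_)
  set E := ∫ ω, Real.sqrt (Z ω) * Real.sqrt (R ω) ∂P
  -- The integral of `(t √Z - √R)²` is a nonnegative quadratic in `t`; its discriminant gives the
  -- inequality.
  have h : ∀ t : ℝ, 0 ≤ (∫ ω, Z ω ∂P) * (t * t) + (-2 * E) * t + ∫ ω, R ω ∂P := by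
    intro t
    have h1 : ∫ ω, ((t * t) * Z ω + ((-2 * t) * (Real.sqrt (Z ω) * Real.sqrt (R ω)) + R ω)) ∂P =
        (∫ ω, Z ω ∂P) * (t * t) + (-2 * E) * t + ∫ ω, R ω ∂P := by
      rw [integral_add (hZ.const_mul _) (by exact (hI.const_mul _).add hR),
        integral_add (hI.const_mul _) hR, integral_const_mul, integral_const_mul]
      ring
    rw [← h1]
    refine integral_nonneg_of_ae ?_
    filter_upwards [hZ0, hR0] with ω h2 h3
    have h4 := Real.sq_sqrt h2
    have h5 := Real.sq_sqrt h3
    simp only [Pi.zero_apply]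
    nlinarith [sq_nonneg (t * Real.sqrt (Z ω) - Real.sqrt (R ω))]
  have := discrim_le_zero h
  rw [discrim] at this
  nlinarith

end

/-- The two self-bounding inequalities give the oracle inequality. -/
theorem risk_le_of_selfbound {a b c s t : ℝ} (ha : 0 ≤ a) (hb : 0 ≤ b) (hc : 1 ≤ c)
    (ht : 0 ≤ t) (h : s ^ 2 ≤ t ^ 2 + c * (a + b) * s + c * b * t) :
    t ^ 2 + c * (a + b) * s + c * b * t ≤
      t ^ 2 + 4 * c ^ 2 * (a ^ 2 + a * t + (b ^ 2 + b * t)) := by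
  have hd : 0 ≤ c * (a + b) := by positivity
  -- A larger `s` would make `s²` exceed the right-hand side of `h`; substituting this bound back
  -- removes `s`.
  have h1 : s ≤ t + 2 * (c * (a + b)) := by
    by_contra hcon
    push Not at hcon
    have h2 : c * b * t ≤ c * (a + b) * t := by
      have : 0 ≤ c * a * t := by positivity
      nlinarith
    nlinarith [mul_nonneg hd ht, mul_nonneg hd hd]
  have h2 := mul_le_mul_of_nonneg_left h1 hd
  have h3 : c ≤ c ^ 2 := by nlinarith
  have h4 : c * (a + 2 * b) * t ≤ c ^ 2 * (a + 2 * b) * t := by gcongr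
  have h5 : 0 ≤ c ^ 2 * a * t := by positivity
  have h6 : 0 ≤ c ^ 2 * b * t := by positivity
  have h7 : 0 ≤ c ^ 2 * (a - b) ^ 2 := by positivity
  nlinarith

/-- Chaining `hA` into `hB` gives `√r` coefficients `9 q a + 2 b`, so `c = 9 q + 2` covers all
terms. The same right-hand side bounds `L` and `r`, hence both risks obey one bound. -/
theorem le_of_selfbound {a b q r t L : ℝ} (ha : 0 ≤ a) (hb : 0 ≤ b) (hq : 0 ≤ q) (hr : 0 ≤ r)
    (ht : 0 ≤ t) (hA : L ≤ t + (4 * q * a + 2 * b) * Real.sqrt r + 2 * b * Real.sqrt t)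
    (hB : r ≤ L + 5 * q * a * Real.sqrt r) {B : ℝ}
    (hbound : B = Real.sqrt t ^ 2 + 4 * (9 * q + 2) ^ 2 *
      (a ^ 2 + a * Real.sqrt t + (b ^ 2 + b * Real.sqrt t))) : L ≤ B ∧ r ≤ B := by
  have hts := Real.sq_sqrt ht
  have hrs := Real.sq_sqrt hr
  have htn := Real.sqrt_nonneg t
  have hsn := Real.sqrt_nonneg r
  have e1 : 0 ≤ q * a * Real.sqrt r := by positivity
  have e2 : 0 ≤ q * b * Real.sqrt r := by positivity
  have e3 : 0 ≤ q * b * Real.sqrt t := by positivity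
  have e4 : 0 ≤ a * Real.sqrt r := by positivity
  have e5 : 0 ≤ b * Real.sqrt t := by positivity
  have h1 : r ≤ Real.sqrt t ^ 2 + (9 * q + 2) * (a + b) * Real.sqrt r +
      (9 * q + 2) * b * Real.sqrt t := by linarith
  have h2 : L ≤ Real.sqrt t ^ 2 + (9 * q + 2) * (a + b) * Real.sqrt r +
      (9 * q + 2) * b * Real.sqrt t := by linarith
  have h3 := risk_le_of_selfbound ha hb (show 1 ≤ 9 * q + 2 by linarith) htn (hrs.le.trans h1)
  rw [hbound]
  exact ⟨h2.trans h3, h1.trans h3⟩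

/-- Matches the stated bound with the form `t² + C (a² + a t + b² + b t)` of the self-bounding
argument; `n * rhoTerm` is `b² + b t`. -/
theorem mul_riskBound {n kmax : ℕ} (hn : 0 < n) {C σ mse ψ r : ℝ} (hmse : 0 ≤ mse) (hψ : 0 ≤ ψ)
    (hr : 0 ≤ n * r) :
    n * riskBound C n kmax σ mse ψ r = Real.sqrt (n * r) ^ 2 +
      C * ((σ * Real.sqrt ψ) ^ 2 + σ * Real.sqrt ψ * Real.sqrt (n * r) +
        (Real.sqrt (kmax / σ ^ 2 * mse) ^ 2 +
          Real.sqrt (kmax / σ ^ 2 * mse) * Real.sqrt (n * r))) := by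
  have hn' : (0 : ℝ) < n := by exact_mod_cast hn
  have hv : 0 ≤ (kmax : ℝ) / σ ^ 2 * mse := by positivity
  rw [riskBound, rhoTerm, Real.sq_sqrt hr, mul_pow, Real.sq_sqrt hψ, Real.sq_sqrt hv]
  have h1 : (kmax : ℝ) / (n * σ ^ 2) * mse = (kmax / σ ^ 2 * mse) / n := by
    rw [div_mul_eq_mul_div, div_mul_eq_mul_div, div_div, mul_comm (σ ^ 2)]
  have h2 : Real.sqrt r = Real.sqrt (n * r) / Real.sqrt n := by
    rw [Real.sqrt_mul hn'.le]
    field_simp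
  have hs : Real.sqrt n ≠ 0 := (Real.sqrt_pos.2 hn').ne'
  have h3 : (n : ℝ) = Real.sqrt n * Real.sqrt n := (Real.mul_self_sqrt hn'.le).symm
  rw [h1, Real.sqrt_div hv, h2]
  set y := Real.sqrt (n * r)
  set v := (kmax : ℝ) / σ ^ 2 * mse
  have e1 : (n : ℝ) * (C * σ ^ 2 / n * ψ) = C * (σ ^ 2 * ψ) := by field_simp
  have e2 : (n : ℝ) * (C * σ / Real.sqrt n * Real.sqrt ψ * (y / Real.sqrt n)) =
      C * (σ * Real.sqrt ψ * y) := by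
    have : C * σ / Real.sqrt n * Real.sqrt ψ * (y / Real.sqrt n) =
        C * σ * Real.sqrt ψ * y / n := by
      rw [div_mul_eq_mul_div, div_mul_div_comm, ← h3]
    rw [this]
    field_simp
  have e3 : (n : ℝ) * (C * (v / n + Real.sqrt v / Real.sqrt n * (y / Real.sqrt n))) =
      C * (v + Real.sqrt v * y) := by
    have : Real.sqrt v / Real.sqrt n * (y / Real.sqrt n) = Real.sqrt v * y / n := by
      rw [div_mul_div_comm, ← h3]
    rw [this]
    field_simp
  rw [mul_add, mul_add, mul_add, e1, e2, e3]
  ring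


/-! ### Integrability and the inequalities in expectation -/

section
variable {Ω : Type*} [MeasurableSpace Ω] {P : Measure Ω} {M : ℕ}

theorem aestronglyMeasurable_weightTail {what : Ω → Fin M → ℝ} (hw : AEMeasurable what P) (m : ℕ) :
    AEStronglyMeasurable (fun ω => weightTail (what ω) m) P := by
  have hc : Measurable fun w : Fin M → ℝ => weightTail w m := by
    unfold weightTail
    refine Finset.measurable_sum _ fun j _ => ?_
    split_ifs
    · exact measurable_pi_apply j
    · exact measurable_const
  exact (hc.comp_aemeasurable hw).aestronglyMeasurable

theorem integrable_weightTail_mul {what : Ω → Fin M → ℝ} (hw : AEMeasurable what P)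
    (hs : ∀ᵐ ω ∂P, what ω ∈ stdSimplex ℝ (Fin M)) (m : ℕ) {H : Ω → ℝ} (hH : Integrable H P) :
    Integrable (fun ω => weightTail (what ω) m * H ω) P := by
  refine hH.bdd_mul (c := 1) (aestronglyMeasurable_weightTail hw m) ?_
  filter_upwards [hs] with ω hω
  rw [Real.norm_of_nonneg (weightTail_nonneg hω m)]
  exact weightTail_le_one hω m

variable [IsProbabilityMeasure P] {n p : ℕ} {X : Matrix (Fin n) (Fin p) ℝ}
  {φ : Fin p → Fin n → ℝ} {ε : Fin n → Ω → ℝ} {k : ℕ → ℕ} {σ : ℝ}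

theorem integrable_mul_plugInRisk (hn : 0 < n) (hX : LinearIndependent ℝ X.col)
    (hφ : IsNestedBasis X φ) (hk0 : k 0 = 0) (hk : ∀ m < M, k m < k (m + 1)) (f : Fin n → ℝ)
    {what : Ω → Fin M → ℝ} (hw : AEMeasurable what P)
    (hs : ∀ᵐ ω ∂P, what ω ∈ stdSimplex ℝ (Fin M)) :
    Integrable (fun ω => n * plugInRisk X (nestedModels p M k) f σ (what ω)) P := by
  simp only [mul_plugInRisk hn hX hφ hk0 hk]
  refine (integrable_const _).add (integrable_finsetSum _ fun m _ => ?_)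
  have h1 : ∀ c : ℝ, Integrable (fun ω => weightTail (what ω) m * c) P := fun c =>
    integrable_weightTail_mul hw hs m (integrable_const c)
  have h2 : ∀ c : ℝ, Integrable (fun ω => weightTail (what ω) m * (weightTail (what ω) m * c)) P :=
    fun c => integrable_weightTail_mul hw hs m (h1 c)
  refine ((((h2 (biasTerm φ k f m)).sub (h1 (2 * biasTerm φ k f m)))).add
    (h2 (σ ^ 2 * dimTerm p k m))).congr (Filter.Eventually.of_forall fun ω => ?_)
  simp only [Pi.add_apply, Pi.sub_apply]
  ring

theorem integrable_mul_maLoss (hn : 0 < n) (hX : LinearIndependent ℝ X.col)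
    (hφ : IsNestedBasis X φ) (h4 : ∀ i, MemLp (ε i) 4 P) (hk0 : k 0 = 0)
    (hk : ∀ m < M, k m < k (m + 1)) (f : Fin n → ℝ)
    {what : Ω → Fin M → ℝ} (hw : AEMeasurable what P)
    (hs : ∀ᵐ ω ∂P, what ω ∈ stdSimplex ℝ (Fin M)) :
    Integrable (fun ω => n * maLoss X (nestedModels p M k) f (what ω)
      (f + fun i => ε i ω)) P := by
  -- The loss does not involve `σ`, so the expansion may be centred at `0`.
  simp only [mul_maLoss hn hX hφ hk0 hk 0]
  refine (integrable_const _).add (integrable_finsetSum _ fun m _ => ?_)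
  have hU : Integrable (fun ω => crossTerm φ k f (fun i => ε i ω) m) P :=
    (memLp_crossTerm h4 f m).integrable (by norm_num)
  have hV : Integrable (fun ω => quadTerm φ k 0 (fun i => ε i ω) m) P :=
    (memLp_quadTerm hφ h4 m).integrable (by norm_num)
  refine ((integrable_weightTail_mul hw hs m (integrable_weightTail_mul hw hs m
    ((((integrable_const (biasTerm φ k f m)).add (hU.const_mul 2)).add hV).add
      (integrable_const (0 ^ 2 * dimTerm p k m))))).sub
    ((integrable_weightTail_mul hw hs m ((integrable_const (biasTerm φ k f m)).add hU)).const_mul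
      2)).congr (Filter.Eventually.of_forall fun ω => ?_)
  simp only [Pi.add_apply, Pi.sub_apply]
  ring

section
variable (hn : 0 < n) (hX : LinearIndependent ℝ X.col) (hφ : IsNestedBasis X φ)
  (hind : iIndepFun ε P) (h4 : ∀ i, MemLp (ε i) 4 P) (h0 : ∀ i, ∫ ω, ε i ω ∂P = 0)
  (h2 : ∀ i, ∫ ω, ε i ω ^ 2 ∂P = σ ^ 2)

include hX hφ hind h4 h0 h2 in
theorem integral_sum_crossTerm (f : Fin n → ℝ) (g : ℕ → ℝ) :
    Integrable (fun ω => ∑ m ∈ Finset.range M, g m * crossTerm φ k f (fun i => ε i ω) m) P ∧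
    ∫ ω, ∑ m ∈ Finset.range M, g m * crossTerm φ k f (fun i => ε i ω) m ∂P = 0 := by
  have hU : ∀ m, Integrable (fun ω => g m * crossTerm φ k f (fun i => ε i ω) m) P := fun m =>
    ((memLp_crossTerm h4 f m).integrable (by norm_num)).const_mul _
  refine ⟨integrable_finsetSum _ fun m _ => hU m, ?_⟩
  rw [integral_finsetSum _ fun m _ => hU m]
  refine Finset.sum_eq_zero fun m _ => ?_
  rw [integral_const_mul]
  simp only [crossTerm, blockSum]
  rw [(integral_crossTerm hX hφ hind h4 h0 h2 f _).1, mul_zero]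

include hX hφ hind h4 h0 h2 in
theorem integral_sum_quadTerm {c : ℝ} (hm4 : ∀ i, ∫ ω, ε i ω ^ 4 ∂P ≤ c) (g : ℕ → ℝ) :
    Integrable (fun ω => ∑ m ∈ Finset.range M, g m * quadTerm φ k σ (fun i => ε i ω) m) P ∧
    ∫ ω, ∑ m ∈ Finset.range M, g m * quadTerm φ k σ (fun i => ε i ω) m ∂P = 0 := by
  have hU : ∀ m, Integrable (fun ω => g m * quadTerm φ k σ (fun i => ε i ω) m) P := fun m =>
    ((memLp_quadTerm hφ h4 m).integrable (by norm_num)).const_mul _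
  refine ⟨integrable_finsetSum _ fun m _ => hU m, ?_⟩
  rw [integral_finsetSum _ fun m _ => hU m]
  refine Finset.sum_eq_zero fun m _ => ?_
  rw [integral_const_mul]
  simp only [quadTerm, blockSum]
  rw [(integral_quadTerm hX hφ hind h4 h0 h2 hm4 _).1, mul_zero]

include hn hX hφ hind h4 h0 h2 in
/-- For a fixed weight vector the risk is the plug-in expression. -/
theorem integral_mul_maLoss {c : ℝ} (hm4 : ∀ i, ∫ ω, ε i ω ^ 4 ∂P ≤ c) (hk0 : k 0 = 0)
    (hk : ∀ m < M, k m < k (m + 1)) (f : Fin n → ℝ) (w : Fin M → ℝ) :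
    ∫ ω, n * maLoss X (nestedModels p M k) f w (f + fun i => ε i ω) ∂P =
      n * plugInRisk X (nestedModels p M k) f σ w := by
  obtain ⟨i1, e1⟩ := integral_sum_crossTerm (M := M) (k := k) hX hφ hind h4 h0 h2 f
    fun m => 1 - weightTail w m
  obtain ⟨i2, e2⟩ := integral_sum_crossTerm (M := M) (k := k) hX hφ hind h4 h0 h2 f
    fun m => (1 - weightTail w m) ^ 2
  obtain ⟨i3, e3⟩ := integral_sum_quadTerm (M := M) (k := k) hX hφ hind h4 h0 h2 hm4
    fun m => weightTail w m ^ 2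
  simp only [mul_maLoss_eq_risk_add (σ := σ) hn hX hφ hk0 hk]
  have e4 : ∫ ω, 2 * (∑ m ∈ Finset.range M,
      (1 - weightTail w m) * crossTerm φ k f (fun i => ε i ω) m -
      ∑ m ∈ Finset.range M, (1 - weightTail w m) ^ 2 * crossTerm φ k f (fun i => ε i ω) m) ∂P =
      0 := by
    rw [integral_const_mul, integral_sub i1 i2, e1, e2]
    simp
  rw [integral_add (by exact (integrable_const _).sub ((i1.sub i2).const_mul 2)) i3,
    integral_sub (integrable_const _) (by exact (i1.sub i2).const_mul 2), e3, e4]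
  simp

end

/-- The two self-bounding inequalities for the risk of the averaging estimator, in terms of
`r = n E R_n(what)`. -/
theorem integral_risk_selfbound {κ : ℝ} (hn : 0 < n) (hX : LinearIndependent ℝ X.col)
    (hφ : IsNestedBasis X φ)
    (hσ : 0 < σ) (hind : iIndepFun ε P) (h4 : ∀ i, MemLp (ε i) 4 P)
    (h0 : ∀ i, ∫ ω, ε i ω ∂P = 0) (h2 : ∀ i, ∫ ω, ε i ω ^ 2 ∂P = σ ^ 2)
    (hm4 : ∀ i, ∫ ω, ε i ω ^ 4 ∂P ≤ 144 * κ ^ 4 * σ ^ 4) (hM : 1 ≤ M) (hk0 : k 0 = 0)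
    (hk : ∀ m < M, k m < k (m + 1)) (hkp : k M ≤ p) (f : Fin n → ℝ)
    {s : Ω → ℝ} (hs : MemLp s 2 P) {what : Ω → Fin M → ℝ} (hw : AEMeasurable what P)
    (hmin : ∀ᵐ ω ∂P, what ω ∈ stdSimplex ℝ (Fin M) ∧
      IsMinOn (mmaCriterion X (nestedModels p M k) (s ω) (f + fun i => ε i ω))
        (stdSimplex ℝ (Fin M)) (what ω))
    {v : Fin M → ℝ} (hv : v ∈ stdSimplex ℝ (Fin M)) {q a b r t L : ℝ}
    (hq : q = Real.sqrt (192 * (288 * κ ^ 4 + 9)))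
    (ha : a = σ * Real.sqrt (psi (transCoeff φ f) k M))
    (hb : b = Real.sqrt (k M / σ ^ 2 * ∫ ω, (s ω - σ ^ 2) ^ 2 ∂P))
    (hr : r = ∫ ω, n * plugInRisk X (nestedModels p M k) f σ (what ω) ∂P)
    (ht : t = n * plugInRisk X (nestedModels p M k) f σ v)
    (hL : L = ∫ ω, n * maLoss X (nestedModels p M k) f (what ω) (f + fun i => ε i ω) ∂P) :
    L ≤ t + (4 * q * a + 2 * b) * Real.sqrt r + 2 * b * Real.sqrt t ∧
    r ≤ L + 5 * q * a * Real.sqrt r := by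
  have hws : ∀ᵐ ω ∂P, what ω ∈ stdSimplex ℝ (Fin M) := hmin.mono fun ω h => h.1
  have hψ := psi_nonneg (k := k) hM hk (transCoeff φ f)
  set ψ := psi (transCoeff φ f) k M with hψdef
  set R : Ω → ℝ := fun ω => n * plugInRisk X (nestedModels p M k) f σ (what ω) with hR
  set Lω : Ω → ℝ := fun ω =>
    n * maLoss X (nestedModels p M k) f (what ω) (f + fun i => ε i ω) with hLω
  have hRi : Integrable R P := integrable_mul_plugInRisk hn hX hφ hk0 hk f hw hws
  have hLi : Integrable Lω P := integrable_mul_maLoss hn hX hφ h4 hk0 hk f hw hws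
  have hR0 : ∀ ω, 0 ≤ R ω := fun ω => plugInRisk_nonneg hn hX hφ hk0 hk σ f (what ω)
  have ht0 : 0 ≤ t := ht ▸ plugInRisk_nonneg hn hX hφ hk0 hk σ f v
  obtain ⟨Z₁, hZ₁i, hZ₁0, hZ₁E, hZ₁⟩ :=
    exists_crossTerm_bound hn hX hφ hind h4 h0 h2 hM hk f
  obtain ⟨Z₂, hZ₂i, hZ₂0, hZ₂E, hZ₂⟩ :=
    exists_quadTerm_bound hX hφ hind h4 h0 h2 (by positivity) hm4 hM hk0 hk hkp (transCoeff φ f)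
  rw [← hψdef] at hZ₁E hZ₂E
  have hκ : 0 ≤ κ ^ 4 := by positivity
  have ha0 : 0 ≤ a := by rw [ha]; positivity
  have hqa : q * a = Real.sqrt (192 * (288 * κ ^ 4 + 9) * (σ ^ 2 * ψ)) := by
    rw [hq, ha, Real.sqrt_mul (show 0 ≤ 192 * (288 * κ ^ 4 + 9) by positivity) (σ ^ 2 * ψ),
      Real.sqrt_mul (sq_nonneg σ), Real.sqrt_sq hσ.le]
  have hσψ : 0 ≤ σ ^ 2 * ψ := by positivity
  -- One constant `q` serves both noise terms: `2 * 144 * κ ^ 4 + 8` from the quadratic forms,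
  -- rounded up, also dominates the `1` of the linear ones.
  have hE1 : Real.sqrt (∫ ω, Z₁ ω ∂P) ≤ q * a := by
    rw [hqa]
    refine Real.sqrt_le_sqrt (hZ₁E.trans ?_)
    nlinarith [mul_nonneg hκ hσψ]
  have hE2 : Real.sqrt (∫ ω, Z₂ ω / σ ^ 2 ∂P) ≤ q * a := by
    rw [hqa, integral_div]
    refine Real.sqrt_le_sqrt ?_
    rw [div_le_iff₀ (by positivity)]
    refine hZ₂E.trans ?_
    have h5 : 0 ≤ σ ^ 2 * (σ ^ 2 * ψ) := by positivity
    nlinarith [mul_nonneg hκ h5]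
  have hD0 : ∀ ω, 0 ≤ (s ω - σ ^ 2) ^ 2 := fun ω => sq_nonneg _
  have hDi : Integrable (fun ω => (s ω - σ ^ 2) ^ 2) P := (hs.sub (memLp_const _)).integrable_sq
  obtain ⟨j1, c1⟩ := integral_sqrt_mul_sqrt_le hZ₁i hRi (Filter.Eventually.of_forall hZ₁0)
    (Filter.Eventually.of_forall hR0)
  obtain ⟨j2, c2⟩ := integral_sqrt_mul_sqrt_le (hZ₂i.div_const (σ ^ 2)) hRi
    (Filter.Eventually.of_forall fun ω => div_nonneg (hZ₂0 ω) (sq_nonneg σ))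
    (Filter.Eventually.of_forall hR0)
  obtain ⟨j3, c3⟩ := integral_sqrt_mul_sqrt_le hDi hRi (Filter.Eventually.of_forall hD0)
    (Filter.Eventually.of_forall hR0)
  obtain ⟨j4, c4⟩ := integral_sqrt_mul_sqrt_le hDi (integrable_const t)
    (Filter.Eventually.of_forall hD0) (Filter.Eventually.of_forall fun _ => ht0)
  rw [← hr] at c1 c2 c3
  rw [integral_const, probReal_univ, one_smul] at c4
  have hb' : b = Real.sqrt (k M / σ ^ 2) * Real.sqrt (∫ ω, (s ω - σ ^ 2) ^ 2 ∂P) := by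
    rw [hb, Real.sqrt_mul (by positivity)]
  set d := Real.sqrt (k M / σ ^ 2) with hd
  have hd0 : 0 ≤ d := Real.sqrt_nonneg _
  have hsr := Real.sqrt_nonneg r
  have c1' := c1.trans (mul_le_mul_of_nonneg_right hE1 hsr)
  have c2' := c2.trans (mul_le_mul_of_nonneg_right hE2 hsr)
  have hLv : Integrable (fun ω => n * maLoss X (nestedModels p M k) f v (f + fun i => ε i ω)) P :=
    integrable_mul_maLoss hn hX hφ h4 hk0 hk f aemeasurable_const
      (Filter.Eventually.of_forall fun _ => hv)
  obtain ⟨i1, e1⟩ := integral_sum_crossTerm (M := M) (k := k) hX hφ hind h4 h0 h2 f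
    fun m => 1 - weightTail v m
  obtain ⟨i2, e2⟩ := integral_sum_quadTerm (M := M) (k := k) hX hφ hind h4 h0 h2 hm4
    fun m => weightTail v m
  -- Noise terms at the fixed weight `v` have mean zero; only those at the random weight need the
  -- uniform bounds.
  have e1' : ∫ ω, 2 * (∑ m ∈ Finset.range M,
      (1 - weightTail v m) * crossTerm φ k f (fun i => ε i ω) m) ∂P = 0 := by
    rw [integral_const_mul, e1, mul_zero]
  have e2' : ∫ ω, -2 * (∑ m ∈ Finset.range M,
      weightTail v m * quadTerm φ k σ (fun i => ε i ω) m) ∂P = 0 := by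
    rw [integral_const_mul, e2, mul_zero]
  have hr' : ∫ ω, R ω ∂P = r := hr.symm
  have hL' : ∫ ω, Lω ω ∂P = L := hL.symm
  constructor
  · have hpt : ∀ᵐ ω ∂P, Lω ω ≤
        (n * maLoss X (nestedModels p M k) f v (f + fun i => ε i ω)) +
        (2 * (∑ m ∈ Finset.range M, (1 - weightTail v m) * crossTerm φ k f (fun i => ε i ω) m) +
        (-2 * (∑ m ∈ Finset.range M, weightTail v m * quadTerm φ k σ (fun i => ε i ω) m) +
        (2 * (Real.sqrt (Z₁ ω) * Real.sqrt (R ω)) +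
        (2 * (Real.sqrt (Z₂ ω / σ ^ 2) * Real.sqrt (R ω)) +
        (2 * d * (Real.sqrt ((s ω - σ ^ 2) ^ 2) * Real.sqrt (R ω)) +
          2 * d * (Real.sqrt ((s ω - σ ^ 2) ^ 2) * Real.sqrt t)))))) := by
      filter_upwards [hmin, hZ₁, hZ₂] with ω hω h₁ h₂
      have h5 := mul_maLoss_le_of_isMinOn (σ := σ) hn hX hφ hk0 hk hv hω.2
      obtain ⟨n1, n2, n3, n4⟩ := noise_le hn hX hφ hk0 hk hσ hω.1 (hZ₁0 ω) (hZ₂0 ω) h₁ h₂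
      have n5 := sum_weightTail_mul_dimTerm_le hn hX hφ hk0 hk hσ hkp f (what ω)
      have n6 := sum_weightTail_mul_dimTerm_le hn hX hφ hk0 hk hσ hkp f v
      rw [← ht] at n6
      have h6 : ∑ m ∈ Finset.range M, crossTerm φ k f (fun i => ε i ω) m -
          ∑ m ∈ Finset.range M, weightTail v m * (crossTerm φ k f (fun i => ε i ω) m +
            quadTerm φ k σ (fun i => ε i ω) m) =
          ∑ m ∈ Finset.range M, (1 - weightTail v m) * crossTerm φ k f (fun i => ε i ω) m -
          ∑ m ∈ Finset.range M, weightTail v m * quadTerm φ k σ (fun i => ε i ω) m := by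
        rw [← Finset.sum_sub_distrib, ← Finset.sum_sub_distrib]
        exact Finset.sum_congr rfl fun m _ => by ring
      rw [h6] at h5
      have h7 : (σ ^ 2 - s ω) * (∑ m ∈ Finset.range M, weightTail (what ω) m * dimTerm p k m -
          ∑ m ∈ Finset.range M, weightTail v m * dimTerm p k m) ≤
          Real.sqrt ((s ω - σ ^ 2) ^ 2) * (d * Real.sqrt (R ω) + d * Real.sqrt t) := by
        refine (le_abs_self _).trans ?_
        rw [abs_mul, Real.sqrt_sq_eq_abs, abs_sub_comm]
        refine mul_le_mul_of_nonneg_left ?_ (abs_nonneg _)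
        exact (abs_sub _ _).trans (add_le_add n5 n6)
      have h8 := neg_le_of_abs_le n1
      have h9 := le_of_abs_le n3
      change Lω ω ≤ _ at h5
      change -(Real.sqrt (Z₁ ω) * Real.sqrt (R ω)) ≤ _ at h8
      change _ ≤ Real.sqrt (Z₂ ω / σ ^ 2) * Real.sqrt (R ω) at h9
      linarith
    have k6 := (j3.const_mul (2 * d)).add (j4.const_mul (2 * d))
    have k5 := (j2.const_mul 2).add k6
    have k4 := (j1.const_mul 2).add k5
    have k3 := (i2.const_mul (-2)).add k4
    have k2 := (i1.const_mul 2).add k3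
    have hint := integral_mono_ae hLi (hLv.add k2) hpt
    rw [integral_add' hLv k2, integral_add' (i1.const_mul 2) k3,
      integral_add' (i2.const_mul (-2)) k4, integral_add' (j1.const_mul 2) k5,
      integral_add' (j2.const_mul 2) k6, integral_add' (j3.const_mul _) (j4.const_mul _),
      integral_const_mul 2 fun ω => Real.sqrt (Z₁ ω) * Real.sqrt (R ω),
      integral_const_mul 2 fun ω => Real.sqrt (Z₂ ω / σ ^ 2) * Real.sqrt (R ω),
      integral_const_mul (2 * d) fun ω => Real.sqrt ((s ω - σ ^ 2) ^ 2) * Real.sqrt (R ω),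
      integral_const_mul (2 * d) fun ω => Real.sqrt ((s ω - σ ^ 2) ^ 2) * Real.sqrt t, e1', e2',
      integral_mul_maLoss hn hX hφ hind h4 h0 h2 hm4 hk0 hk, ← ht, hL'] at hint
    have c3' := mul_le_mul_of_nonneg_left c3 hd0
    have c4' := mul_le_mul_of_nonneg_left c4 hd0
    rw [← mul_assoc, ← hb'] at c3' c4'
    linarith
  · have hpt : ∀ᵐ ω ∂P, R ω ≤ Lω ω + (4 * (Real.sqrt (Z₁ ω) * Real.sqrt (R ω)) +
        Real.sqrt (Z₂ ω / σ ^ 2) * Real.sqrt (R ω)) := by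
      filter_upwards [hmin, hZ₁, hZ₂] with ω hω h₁ h₂
      obtain ⟨n1, n2, n3, n4⟩ := noise_le hn hX hφ hk0 hk hσ hω.1 (hZ₁0 ω) (hZ₂0 ω) h₁ h₂
      have h5 := mul_maLoss_eq_risk_add (σ := σ) hn hX hφ hk0 hk f (fun i => ε i ω) (what ω)
      change Lω ω = R ω - _ + _ at h5
      have h7 := le_of_abs_le n1
      have h8 := neg_le_of_abs_le n2
      have h9 := neg_le_of_abs_le n4
      change _ ≤ Real.sqrt (Z₁ ω) * Real.sqrt (R ω) at h7
      change -(Real.sqrt (Z₁ ω) * Real.sqrt (R ω)) ≤ _ at h8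
      change -(Real.sqrt (Z₂ ω / σ ^ 2) * Real.sqrt (R ω)) ≤ _ at h9
      linarith
    have k2 := (j1.const_mul 4).add j2
    have hint := integral_mono_ae hRi (hLi.add k2) hpt
    rw [integral_add' hLi k2, integral_add' (j1.const_mul 4) j2,
      integral_const_mul 4 fun ω => Real.sqrt (Z₁ ω) * Real.sqrt (R ω), hr', hL'] at hint
    linarith

end
end MMA

/-! ### The risk bound -/

theorem theorem1 (κ : ℝ) :
    ∃ C : ℝ, 0 < C ∧
      ∀ (Ω : Type*) [MeasurableSpace Ω] (P : Measure Ω) [IsProbabilityMeasure P]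
        (n p M : ℕ)
        -- the regression model: a design of full column rank and i.i.d. sub-Gaussian errors
        (X : Matrix (Fin n) (Fin p) ℝ) (_ : LinearIndependent ℝ X.col)
        (β : Fin p → ℝ) (f : Fin n → ℝ) (_ : f = X *ᵥ β)
        (ε : Fin n → Ω → ℝ) (σ : ℝ) (η : NNReal) (_ : 0 < σ)
        (_ : iIndepFun ε P) (_ : ∀ i j, IdentDistrib (ε i) (ε j) P P)
        (_ : ∀ i, ∫ ω, ε i ω ∂P = 0) (_ : ∀ i, ∫ ω, ε i ω ^ 2 ∂P = σ ^ 2)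
        (_ : ∀ i, HasSubgaussianMGF (ε i) (η ^ 2) P) (_ : (η : ℝ) ≤ κ * σ)
        -- the transformed coefficients
        (φ : Fin p → Fin n → ℝ) (_ : MMA.IsNestedBasis X φ)
        -- the nested candidate set: `0 = k 0 < k 1 < ⋯ < k M ≤ p`, with `M ≥ 1`
        (k : ℕ → ℕ) (_ : 1 ≤ M) (_ : k 0 = 0) (_ : ∀ j < M, k j < k (j + 1)) (_ : k M ≤ p)
        -- the variance estimator, with finite mean squared error
        (s : Ω → ℝ) (_ : MemLp s 2 P)
        -- the weights that minimize the criterion over the simplex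
        (what : Ω → Fin M → ℝ) (_ : AEMeasurable what P)
        (_ : ∀ᵐ ω ∂P, what ω ∈ stdSimplex ℝ (Fin M) ∧
          IsMinOn (MMA.mmaCriterion X (MMA.nestedModels p M k) (s ω) (fun i => f i + ε i ω))
            (stdSimplex ℝ (Fin M)) (what ω))
        -- the weights that minimize the risk over the simplex
        (wstar : Fin M → ℝ) (_ : wstar ∈ stdSimplex ℝ (Fin M))
        (_ : IsMinOn (MMA.maRisk P X (MMA.nestedModels p M k) f ε)
          (stdSimplex ℝ (Fin M)) wstar),
        (Integrable (fun ω => MMA.maLoss X (MMA.nestedModels p M k) f (what ω)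
            (fun i => f i + ε i ω)) P ∧
          ∫ ω, MMA.maLoss X (MMA.nestedModels p M k) f (what ω) (fun i => f i + ε i ω) ∂P ≤
            MMA.riskBound C n (k M) σ (∫ ω, (s ω - σ ^ 2) ^ 2 ∂P)
              (MMA.psi (MMA.transCoeff φ f) k M)
              (MMA.maRisk P X (MMA.nestedModels p M k) f ε wstar)) ∧
        (Integrable (fun ω => MMA.plugInRisk X (MMA.nestedModels p M k) f σ (what ω)) P ∧
          ∫ ω, MMA.plugInRisk X (MMA.nestedModels p M k) f σ (what ω) ∂P ≤
            MMA.riskBound C n (k M) σ (∫ ω, (s ω - σ ^ 2) ^ 2 ∂P)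
              (MMA.psi (MMA.transCoeff φ f) k M)
              (MMA.maRisk P X (MMA.nestedModels p M k) f ε wstar)) := by
  set q := Real.sqrt (192 * (288 * κ ^ 4 + 9)) with hq
  have hq0 : 0 ≤ q := Real.sqrt_nonneg _
  -- The constant `4 c²` of `risk_le_of_selfbound` with `c = 9 q + 2`.
  refine ⟨4 * (9 * q + 2) ^ 2, by positivity, ?_⟩
  intro Ω _ P _ n p M X hX β f _ ε σ η hσ hind _ h0 h2 hsg hη φ hφ k hM hk0 hk hkp s hs what hw
    hmin wstar hv _
  -- For `n = 0` all columns vanish, while `k 0 < k M ≤ p` provides a column that must be nonzero.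
  have hn : 0 < n := by
    rcases Nat.eq_zero_or_pos n with h | h
    · subst h
      have h1 : k 0 < k 1 := hk 0 hM
      have h3 : k 1 ≤ k M := MMA.le_of_strict_steps hk hM le_rfl
      have hp : 0 < p := by omega
      exact absurd (Subsingleton.elim _ _) (hX.ne_zero ⟨0, hp⟩)
    · exact h
  have hn' : (0 : ℝ) < n := by exact_mod_cast hn
  have h4 : ∀ i, MemLp (ε i) 4 P := fun i => by exact_mod_cast (hsg i).memLp 4
  have hm4 : ∀ i, ∫ ω, ε i ω ^ 4 ∂P ≤ 144 * κ ^ 4 * σ ^ 4 := fun i => by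
    refine (MMA.integral_pow_four_le (hsg i)).trans ?_
    have := pow_le_pow_left₀ η.coe_nonneg hη 4
    rw [mul_pow] at this
    linarith
  have hrisk : MMA.maRisk P X (MMA.nestedModels p M k) f ε wstar =
      MMA.plugInRisk X (MMA.nestedModels p M k) f σ wstar := by
    have h := MMA.integral_mul_maLoss hn hX hφ hind h4 h0 h2 hm4 hk0 hk f wstar
    rw [integral_const_mul] at h
    exact mul_left_cancel₀ hn'.ne' h
  have hws : ∀ᵐ ω ∂P, what ω ∈ stdSimplex ℝ (Fin M) := hmin.mono fun ω h => h.1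
  have hRi := MMA.integrable_mul_plugInRisk (σ := σ) hn hX hφ hk0 hk f hw hws
  have hLi := MMA.integrable_mul_maLoss hn hX hφ h4 hk0 hk f hw hws
  obtain ⟨hA, hB⟩ := MMA.integral_risk_selfbound hn hX hφ hσ hind h4 h0 h2 hm4 hM hk0 hk hkp f hs
    hw hmin hv hq rfl rfl rfl rfl rfl
  have hψ := MMA.psi_nonneg hM hk (MMA.transCoeff φ f)
  have hmse : 0 ≤ ∫ ω, (s ω - σ ^ 2) ^ 2 ∂P := integral_nonneg fun ω => sq_nonneg _
  have ht0 := MMA.plugInRisk_nonneg hn hX hφ hk0 hk σ f wstar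
  have hr0 : 0 ≤ ∫ ω, n * MMA.plugInRisk X (MMA.nestedModels p M k) f σ (what ω) ∂P :=
    integral_nonneg fun ω => MMA.plugInRisk_nonneg hn hX hφ hk0 hk σ f (what ω)
  have hbound := MMA.mul_riskBound (kmax := k M) (C := 4 * (9 * q + 2) ^ 2) (σ := σ) hn hmse hψ ht0
  obtain ⟨hX2, hX1⟩ := MMA.le_of_selfbound (mul_nonneg hσ.le (Real.sqrt_nonneg _))
    (Real.sqrt_nonneg _) hq0 hr0 ht0 hA hB hbound
  rw [hrisk]
  have hcancel : ∀ x : ℝ, (n : ℝ)⁻¹ * (n * x) = x := fun x => inv_mul_cancel_left₀ hn'.ne' x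
  refine ⟨⟨?_, ?_⟩, ⟨?_, ?_⟩⟩
  · have h := hLi.const_mul (n : ℝ)⁻¹
    simp only [hcancel] at h
    exact h
  · rw [integral_const_mul] at hX2
    exact le_of_mul_le_mul_left hX2 hn'
  · have h := hRi.const_mul (n : ℝ)⁻¹
    simp only [hcancel] at h
    exact h
  · rw [integral_const_mul] at hX1
    exact le_of_mul_le_mul_left hX1 hn'
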